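/- **Proposition.** Let $n\ge 2$ and let $\mathcal K^n_o$ be the set of convex bodies $K\subset\mathbb R^n$ (compact convex sets) with the origin in their interior. For $K\in\mathcal K^n_o$ and almost every $x\in\partial K$, let $N(x)$ be the outer unit normal of $K$ at $x$, and let $H_j(x)$ be the $j$-th normalized elementary symmetric function of the generalized principal curvatures of $\partial K$ at $x$, that is, of the eigenvalues of the symmetric operator $A$ on $N(x)^\perp$ for which $\partial K$ is near $x$ the graph over $x+N(x)^\perp$, in direction $-N(x)$, of a function with expansion $v\mapsto\frac12\langle Av,v\rangle+o(\|v\|^2)$ as $v\to0$. For real $p\ne -n$ and integers $m,k\ge 0$ put $$\mathcal W^p_{m,k}(K)=\int_{\partial K}\langle x,N(x)\rangle^{m-k+\frac{n(1-p)}{n+p}}\,H_{n-1}^{\frac p{n+p}}\sum_{\substack{i_1,\dots,i_{n-1}\ge0\\ i_1+2i_2+\cdots+(n-1)i_{n-1}=m}}c(n,p,i)\prod_{j=1}^{n-1}\binom{n-1}{j}^{i_j}H_j^{i_j}\,d\mathcal H^{n-1},$$ $$c(n,p,i)=\binom{\frac n{n+p}}{i_1+\cdots+i_{n-1}}\frac{(i_1+\cdots+i_{n-1})!}{i_1!\cdots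 i_{n-1}!},\qquad \mathcal V^p_k(K)=\sum_{m=0}^k\binom{\frac{n(1-p)}{n+p}}{k-m}\mathcal W^p_{m,k}(K),$$ with generalized binomial coefficients $\binom{\alpha}{q}=\alpha(\alpha-1)\cdots(\alpha-q+1)/q!$. Write $\mathcal W_{k,k}=\mathcal W^1_{k,k}$, and let $\mathcal D^n\subset\mathcal K^n_o$ be the set of those $K$ for which all the integrals $\mathcal W^1_{m,k}(K)$, $m,k\ge0$, converge absolutely. Then for every $k\ge1$ one has $\mathcal V^1_k=\mathcal W_{k,k}$, and this functional on $\mathcal D^n$ is neither lower nor upper semicontinuous with respect to the Hausdorff metric. -/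

import Mathlib

open MeasureTheory Topology Asymptotics

noncomputable section

namespace LpSteiner

/-- Euclidean space `ℝⁿ`. -/
abbrev E (n : ℕ) : Type := EuclideanSpace ℝ (Fin n)

variable {n : ℕ}

/-- The class `𝒦ⁿₒ` of convex bodies in `ℝⁿ` (compact convex sets) that contain the origin in
their interior. The type `ConvexBody (E n)` carries the Hausdorff metric. -/
def bodiesAroundOrigin (n : ℕ) : Set (ConvexBody (E n)) :=
  {K | (0 : E n) ∈ interior (K : Set (E n))}

/-- `u` is an outer unit normal vector of `K` at `x`. -/
def IsOuterUnitNormal (K : ConvexBody (E n)) (x u : E n) : Prop :=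
  ‖u‖ = 1 ∧ ∀ y ∈ K, inner ℝ y u ≤ inner ℝ x u

/-- `N(x)`: an outer unit normal vector of `K` at the boundary point `x`. It is unique for
almost every boundary point. -/
def outerNormal (K : ConvexBody (E n)) (x : E n) : E n :=
  Classical.epsilon (IsOuterUnitNormal K x)

/-- The tangent hyperplane at `x`, as a linear subspace: the orthogonal complement of `N(x)`. -/
abbrev tangentSpace (K : ConvexBody (E n)) (x : E n) : Submodule ℝ (E n) :=
  (ℝ ∙ outerNormal K x)ᗮ

/-- Near `x`, the boundary of `K` is the graph of this convex function over the tangent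
hyperplane: the point above `v` is `x + v - boundaryFunction K x v • N(x)`. -/
def boundaryFunction (K : ConvexBody (E n)) (x : E n) (v : tangentSpace K x) : ℝ :=
  sInf {s : ℝ | x + (v : E n) - s • outerNormal K x ∈ K}

/-- `A` is the (generalized) Weingarten map of `K` at `x`: the self-adjoint endomorphism of the
tangent hyperplane for which the boundary function has the second order expansion
`f v = ⟪A v, v⟫ / 2 + o(‖v‖²)`. By the theorem of Alexandrov and Busemann-Feller it exists at
almost every boundary point, and it is then unique. -/
def IsWeingartenMap (K : ConvexBody (E n)) (x : E n)
    (A : tangentSpace K x →ₗ[ℝ] tangentSpace K x) : Prop :=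
  A.IsSymmetric ∧
    (fun v : tangentSpace K x => boundaryFunction K x v - inner ℝ (A v) v / 2)
      =o[𝓝 0] fun v => ‖v‖ ^ 2

open Classical in
/-- The principal curvatures of `K` at `x`: the eigenvalues of the Weingarten map, counted with
multiplicity. -/
def principalCurvatures (K : ConvexBody (E n)) (x : E n) : Multiset ℝ :=
  if h : ∃ A, IsWeingartenMap K x A then h.choose.charpoly.roots else 0

/-- `H_j(x)`: the `j`-th normalized elementary symmetric function of the principal curvatures. -/
def curvatureH (K : ConvexBody (E n)) (j : ℕ) (x : E n) : ℝ :=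
  (principalCurvatures K x).esymm j / ((n - 1).choose j : ℝ)

/-- The surface area measure on `∂K`: the `(n-1)`-dimensional Hausdorff measure, normalized so
that it is Lebesgue measure on hyperplanes, restricted to the boundary of `K`. -/
def surfaceMeasure (K : ConvexBody (E n)) : Measure (E n) :=
  (Measure.euclideanHausdorffMeasure (n - 1)).restrict (frontier (K : Set (E n)))

/-- The sequences `(i_1, …, i_{n-1})` of natural numbers with
`i_1 + 2 i_2 + ⋯ + (n-1) i_{n-1} = m`; the entry with index `j : Fin (n - 1)` is `i_{j+1}`. -/
def indexSequences (n m : ℕ) : Finset (Fin (n - 1) → ℕ) :=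
  (Fintype.piFinset fun _ : Fin (n - 1) => Finset.range (m + 1)).filter
    fun i => ∑ j : Fin (n - 1), ((j : ℕ) + 1) * i j = m

/-- The coefficient `c(n, p, i)`: the generalized binomial coefficient
`n / (n + p)` choose `i_1 + ⋯ + i_{n-1}`, times a multinomial coefficient. -/
def coeffC (n : ℕ) (p : ℝ) (i : Fin (n - 1) → ℕ) : ℝ :=
  Ring.choose ((n : ℝ) / (n + p)) (∑ j, i j) * (Nat.multinomial Finset.univ i : ℝ)

/-- The integrand of the `L_p` Steiner coefficient `𝒲^p_{m,k}(K)`. -/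
def steinerIntegrand (p : ℝ) (m k : ℕ) (K : ConvexBody (E n)) (x : E n) : ℝ :=
  (inner ℝ x (outerNormal K x)) ^ ((m : ℝ) - k + n * (1 - p) / (n + p)) *
    curvatureH K (n - 1) x ^ (p / (n + p)) *
    ∑ i ∈ indexSequences n m, coeffC n p i *
      ∏ j : Fin (n - 1),
        ((n - 1).choose ((j : ℕ) + 1) : ℝ) ^ i j * curvatureH K ((j : ℕ) + 1) x ^ i j

/-- The `L_p` Steiner coefficient `𝒲^p_{m,k}(K)`. -/
def steinerW (p : ℝ) (m k : ℕ) (K : ConvexBody (E n)) : ℝ :=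
  ∫ x, steinerIntegrand p m k K x ∂(surfaceMeasure K)

/-- The `L_p`-Steiner quermassintegral `𝒱^p_k(K)`. -/
def steinerV (p : ℝ) (k : ℕ) (K : ConvexBody (E n)) : ℝ :=
  ∑ m ∈ Finset.range (k + 1),
    Ring.choose ((n : ℝ) * (1 - p) / (n + p)) (k - m) * steinerW p m k K

/-- The bodies in `𝒦ⁿₒ` for which the `L_p` Steiner coefficients are well-defined: all the
defining integrals converge absolutely. -/
def steinerDomain (n : ℕ) (p : ℝ) : Set (ConvexBody (E n)) :=
  {K ∈ bodiesAroundOrigin n |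
    ∀ m k : ℕ, Integrable (steinerIntegrand p m k K) (surfaceMeasure K)}

end LpSteiner

end

namespace LpSteiner

/-! ### Supporting hyperplanes and flat directions -/

/-! For `p = 1` the outer binomial coefficient is `0` choose `k - m`, so only `𝒲_{k,k}` survives.
Its integrand contains the factor `H_{n-1} ^ (1 / (n + 1))`, hence vanishes wherever the Gauss
curvature does. That happens at every boundary point which is the midpoint of a proper segment in
`K` (`curvatureH_eq_zero_of_segment`): almost everywhere on a polytope and on a cylinder.

Discontinuity comes from a concentration of curvature. `rimBody` is a cylinder topped by a slice of
an ellipsoid of height `δ = 1 / l`. On this rim one principal curvature is of order `l`, and the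
others lie between two positive constants. Every elementary symmetric function is then `O(l)`, the
first one is of exact order `l`, and in the sum over `i` the monomial `h_1 ^ k` has the largest
total degree. Its coefficient, `n / (n + 1)` choose `k`, is nonzero because `0 < n / (n + 1) < 1`.
So the integrand has a fixed sign `σ` and size at least `c l ^ k ≥ c l`, while the rim has area at
least a constant times `1 / l`; thus `σ 𝒲_{k,k} ≥ c > 0` uniformly in large `l`
(`exists_le_sign_mul_steinerW`).

Two limits follow. A fixed such body is a limit of polytopes, where the functional is `0`
(`exists_dist_le_curvatureH_eq_zero`). The cylinder, where it is also `0`, is a limit of such bodies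
as `l → ∞` (`dist_rimBody_le`). One limit breaks lower and the other upper semicontinuity; `σ`
decides which. -/

lemma exists_isOuterUnitNormal {n : ℕ} {K : ConvexBody (E n)} (hK : K ∈ bodiesAroundOrigin n)
    {x : E n} (hx : x ∈ frontier (K : Set (E n))) : ∃ u, IsOuterUnitNormal K x u := by
  obtain ⟨f, hf0, hf⟩ := geometric_hahn_banach_of_nonempty_interior_point K.convex hx.2 ⟨0, hK⟩
  set g : E n := (InnerProductSpace.toDual ℝ (E n)).symm f with hg
  have hgf : ∀ y, inner ℝ y g = f y := fun y => by
    rw [real_inner_comm, hg, InnerProductSpace.toDual_symm_apply]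
  have hg0 : g ≠ 0 := by simpa [hg] using hf0
  refine ⟨‖g‖⁻¹ • g, ?_, fun y hy => ?_⟩
  · rw [norm_smul, norm_inv, norm_norm, inv_mul_cancel₀ (norm_ne_zero_iff.2 hg0)]
  · rw [inner_smul_right, inner_smul_right, hgf, hgf]
    exact mul_le_mul_of_nonneg_left (hf y hy) (by positivity)

lemma isOuterUnitNormal_outerNormal {n : ℕ} {K : ConvexBody (E n)}
    (hK : K ∈ bodiesAroundOrigin n) {x : E n} (hx : x ∈ frontier (K : Set (E n))) :
    IsOuterUnitNormal K x (outerNormal K x) :=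
  Classical.epsilon_spec (exists_isOuterUnitNormal hK hx)

lemma mem_tangentSpace_iff {n : ℕ} {K : ConvexBody (E n)} {x v : E n} :
    v ∈ tangentSpace K x ↔ inner ℝ v (outerNormal K x) = 0 := by
  rw [tangentSpace, Submodule.mem_orthogonal_singleton_iff_inner_left]

lemma nonneg_of_sub_smul_mem {n : ℕ} {K : ConvexBody (E n)} {x : E n}
    (hN : IsOuterUnitNormal K x (outerNormal K x)) (v : tangentSpace K x) {s : ℝ}
    (hs : x + (v : E n) - s • outerNormal K x ∈ K) : 0 ≤ s := by
  have h := hN.2 _ hs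
  rw [inner_sub_left, inner_add_left, inner_smul_left, mem_tangentSpace_iff.1 v.2,
    real_inner_self_eq_norm_sq, hN.1] at h
  simp only [conj_trivial] at h
  linarith

lemma boundaryFunction_nonneg {n : ℕ} {K : ConvexBody (E n)} {x : E n}
    (hN : IsOuterUnitNormal K x (outerNormal K x)) (v : tangentSpace K x) :
    0 ≤ boundaryFunction K x v :=
  -- This covers an empty section too, where `sInf` takes the value `0`.
  Real.sInf_nonneg fun _ hs => nonneg_of_sub_smul_mem hN v hs

lemma boundaryFunction_le {n : ℕ} {K : ConvexBody (E n)} {x : E n}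
    (hN : IsOuterUnitNormal K x (outerNormal K x)) (v : tangentSpace K x) {s : ℝ}
    (hs : x + (v : E n) - s • outerNormal K x ∈ K) : boundaryFunction K x v ≤ s :=
  csInf_le ⟨0, fun _ hr => nonneg_of_sub_smul_mem hN v hr⟩ hs

/-- The quadratic form of a second order expansion is a limit of difference quotients. -/
lemma tendsto_quadratic_of_isLittleO {V : Type*} [NormedAddCommGroup V] [InnerProductSpace ℝ V]
    {f : V → ℝ} {A : V →ₗ[ℝ] V}
    (h : (fun v : V => f v - inner ℝ (A v) v / 2) =o[𝓝 0] fun v => ‖v‖ ^ 2) (v : V) :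
    Filter.Tendsto (fun s : ℝ => f (s • v) / s ^ 2) (𝓝[>] 0) (𝓝 (inner ℝ (A v) v / 2)) := by
  have hlim : Filter.Tendsto (fun s : ℝ => s • v) (𝓝[>] 0) (𝓝 0) := by
    have : Filter.Tendsto (fun s : ℝ => s • v) (𝓝 0) (𝓝 ((0 : ℝ) • v)) :=
      (continuous_id.smul continuous_const).tendsto 0
    rw [zero_smul] at this
    exact this.mono_left nhdsWithin_le_nhds
  have h1 := h.comp_tendsto hlim
  have h2 : (fun s : ℝ => ‖s • v‖ ^ 2) =O[𝓝[>] 0] fun s : ℝ => s ^ 2 := by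
    refine IsBigO.of_bound (‖v‖ ^ 2) (Filter.Eventually.of_forall fun s => ?_)
    rw [norm_smul, Real.norm_of_nonneg (by positivity), norm_pow, mul_pow, mul_comm]
  have h3 := (h1.trans_isBigO h2).tendsto_div_nhds_zero
  have h4 := h3.add_const (inner ℝ (A v) v / 2)
  rw [zero_add] at h4
  refine h4.congr' ?_
  filter_upwards [self_mem_nhdsWithin] with s hs
  have hs' : s ≠ 0 := ne_of_gt hs
  simp only [Function.comp, map_smul, inner_smul_left, inner_smul_right, conj_trivial]
  field_simp
  ring

/-- Both quadratic forms are limits of the same difference quotient, and a symmetric operator with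
zero quadratic form is zero. Hence the choice made in `principalCurvatures` is immaterial. -/
lemma IsWeingartenMap.unique {n : ℕ} {K : ConvexBody (E n)} {x : E n}
    {A B : tangentSpace K x →ₗ[ℝ] tangentSpace K x}
    (hA : IsWeingartenMap K x A) (hB : IsWeingartenMap K x B) : A = B := by
  have h : ∀ v, inner ℝ ((A - B) v) v = 0 := fun v => by
    have := tendsto_nhds_unique (tendsto_quadratic_of_isLittleO hA.2 v)
      (tendsto_quadratic_of_isLittleO hB.2 v)
    rw [LinearMap.sub_apply, inner_sub_left]
    linarith
  exact sub_eq_zero.1 (((hA.1.sub hB.1).inner_map_self_eq_zero).1 h)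

lemma principalCurvatures_eq {n : ℕ} {K : ConvexBody (E n)} {x : E n}
    {A : tangentSpace K x →ₗ[ℝ] tangentSpace K x} (hA : IsWeingartenMap K x A) :
    principalCurvatures K x = A.charpoly.roots := by
  have h : ∃ A, IsWeingartenMap K x A := ⟨A, hA⟩
  rw [principalCurvatures, dif_pos h, h.choose_spec.unique hA]

lemma finrank_tangentSpace {n : ℕ} {K : ConvexBody (E n)} {x : E n}
    (hN : IsOuterUnitNormal K x (outerNormal K x)) :
    Module.finrank ℝ (tangentSpace K x) = n - 1 := by
  have h0 : outerNormal K x ≠ 0 := by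
    rw [← norm_ne_zero_iff, hN.1]; exact one_ne_zero
  have h1 := Submodule.finrank_add_finrank_orthogonal (ℝ ∙ outerNormal K x)
  rw [finrank_span_singleton h0, finrank_euclideanSpace_fin] at h1
  change Module.finrank ℝ (ℝ ∙ outerNormal K x)ᗮ = n - 1
  omega

/-- The only submultiset of size `m` that can exist is `s` itself, and its product contains the
factor `0`. -/
lemma esymm_eq_zero_of_zero_mem {s : Multiset ℝ} {m : ℕ} (hs : s.card ≤ m)
    (h0 : (0 : ℝ) ∈ s) : s.esymm m = 0 := by
  rw [Multiset.esymm]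
  refine Multiset.sum_eq_zero fun y hy => ?_
  obtain ⟨t, ht, rfl⟩ := Multiset.mem_map.1 hy
  obtain ⟨hts, htc⟩ := Multiset.mem_powersetCard.1 ht
  rw [Multiset.eq_of_le_of_card_le hts (by omega)]
  exact Multiset.prod_eq_zero h0

/-- If a boundary point is the midpoint of a proper segment in `K`, the Gauss curvature
vanishes there. -/
lemma curvatureH_eq_zero_of_segment {n : ℕ} (hn : 2 ≤ n) {K : ConvexBody (E n)}
    (hK : K ∈ bodiesAroundOrigin n) {x : E n} (hx : x ∈ frontier (K : Set (E n))) {e : E n}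
    (he : e ≠ 0) (h₁ : x + e ∈ K) (h₂ : x - e ∈ K) : curvatureH K (n - 1) x = 0 := by
  have hN := isOuterUnitNormal_outerNormal hK hx
  have hxK : x ∈ K := K.isClosed.frontier_subset hx
  suffices h : (principalCurvatures K x).esymm (n - 1) = 0 by rw [curvatureH, h, zero_div]
  by_cases hex : ∃ A, IsWeingartenMap K x A
  swap
  -- The default is the empty multiset, which has no submultiset of size `n - 1 ≥ 1`. Existence of
  -- the Weingarten map (Alexandrov's theorem) is therefore not needed.
  · rw [principalCurvatures, dif_neg hex, Multiset.esymm,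
      Multiset.powersetCard_eq_empty _ (by simp; omega)]
    simp
  obtain ⟨A, hA⟩ := hex
  have heN : inner ℝ e (outerNormal K x) = 0 := by
    have a := hN.2 _ h₁
    have b := hN.2 _ h₂
    rw [inner_add_left] at a
    rw [inner_sub_left] at b
    linarith
  set v : tangentSpace K x := ⟨e, mem_tangentSpace_iff.2 heN⟩ with hv
  have hpos : ∀ w, 0 ≤ inner ℝ (A w) w := fun w => by
    have := ge_of_tendsto (tendsto_quadratic_of_isLittleO hA.2 w)
      (Filter.Eventually.of_forall fun s =>
        div_nonneg (boundaryFunction_nonneg hN (s • w)) (sq_nonneg s))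
    linarith
  have hzero : inner ℝ (A v) v = 0 := by
    have hlim := tendsto_quadratic_of_isLittleO hA.2 v
    have : (fun s : ℝ => boundaryFunction K x (s • v) / s ^ 2) =ᶠ[𝓝[>] 0] fun _ => 0 := by
      filter_upwards [Ioo_mem_nhdsGT (zero_lt_one' ℝ)] with s hs
      have hmem : x + ((s • v : tangentSpace K x) : E n) - (0 : ℝ) • outerNormal K x ∈ K := by
        have : (1 - s) • x + s • (x + e) ∈ K :=
          K.convex hxK h₁ (by linarith [hs.2]) hs.1.le (by ring)
        convert this using 1
        simp only [hv, Submodule.coe_smul]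
        module
      rw [le_antisymm (boundaryFunction_le hN _ hmem) (boundaryFunction_nonneg hN _), zero_div]
    have := tendsto_nhds_unique hlim (tendsto_const_nhds.congr' this.symm)
    linarith
  have hAv : A v = 0 := by
    rw [← inner_self_eq_zero (𝕜 := ℝ)]
    by_contra hne
    have hlt : 0 < inner ℝ (A v) (A v) :=
      lt_of_le_of_ne real_inner_self_nonneg (Ne.symm hne)
    set a := inner ℝ (A v) (A v)
    set b := inner ℝ (A (A v)) (A v)
    have hsym : inner ℝ (A (A v)) v = a := hA.1 (A v) v
    have hb : 0 ≤ b := hpos (A v)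
    -- Positivity at `v - t • A v` reads `0 ≤ -2ta + t²b`. With `t = a / (b + 1)` one has `tb ≤ a`,
    -- so the right side is at most `-ta < 0`; the `+ 1` allows `b = 0`.
    have := hpos (v - (a / (b + 1)) • A v)
    simp only [map_sub, map_smul, inner_sub_left, inner_sub_right, inner_smul_left,
      inner_smul_right, conj_trivial, hzero, hsym] at this
    change 0 ≤ 0 - a / (b + 1) * a - a / (b + 1) * (a - a / (b + 1) * b) at this
    have h3 : a / (b + 1) * b ≤ a := by
      rw [div_mul_eq_mul_div, div_le_iff₀ (by linarith)]; nlinarith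
    have h4 : 0 < a / (b + 1) := by positivity
    nlinarith
  rw [principalCurvatures_eq hA]
  refine esymm_eq_zero_of_zero_mem ?_ ?_
  · refine (Polynomial.card_roots' _).trans ?_
    rw [LinearMap.charpoly_natDegree, finrank_tangentSpace hN]
  · rw [Polynomial.mem_roots (LinearMap.charpoly_monic A).ne_zero,
      ← Module.End.hasEigenvalue_iff_isRoot_charpoly]
    refine Module.End.hasEigenvalue_of_hasEigenvector (x := v) ⟨?_, ?_⟩
    · rw [Module.End.mem_eigenspace_iff, hAv, zero_smul]
    · intro h
      exact he (congrArg Subtype.val h)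

/-! ### Bodies with vanishing Gauss curvature -/

lemma exists_segment_of_notMem_extremePoints {V : Type*} [AddCommGroup V] [Module ℝ V]
    {s : Set V} (hs : Convex ℝ s) {x : V} (hx : x ∈ s) (hext : x ∉ s.extremePoints ℝ) :
    ∃ e ≠ 0, x + e ∈ s ∧ x - e ∈ s := by
  rw [mem_extremePoints] at hext
  push Not at hext
  obtain ⟨y, hy, z, hz, ⟨a, b, ha, hb, hab, rfl⟩, hne⟩ := hext hx
  have hyz : z - y ≠ 0 := fun h => by
    obtain rfl := sub_eq_zero.1 h
    have : a • z + b • z = z := by rw [← add_smul, hab, one_smul]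
    exact hne this.symm this.symm
  have hc : 0 < min a b := lt_min ha hb
  -- Shifting the weight `min a b` from one endpoint to the other keeps both weights nonnegative.
  refine ⟨min a b • (z - y), smul_ne_zero hc.ne' hyz, ?_, ?_⟩
  · have := hs hy hz (a := a - min a b) (b := b + min a b)
      (by linarith [min_le_left a b]) (by linarith) (by linarith)
    convert this using 1
    module
  · have := hs hy hz (a := a + min a b) (b := b - min a b)
      (by linarith) (by linarith [min_le_right a b]) (by linarith)
    convert this using 1
    module

lemma steinerIntegrand_eq_zero {n : ℕ} {K : ConvexBody (E n)} {x : E n}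
    (h : curvatureH K (n - 1) x = 0) (m k : ℕ) : steinerIntegrand 1 m k K x = 0 := by
  have : (1 : ℝ) / (n + 1) ≠ 0 := by positivity
  rw [steinerIntegrand, h, Real.zero_rpow this, mul_zero, zero_mul]

lemma surfaceMeasure_ae_mem_frontier {n : ℕ} (K : ConvexBody (E n)) :
    ∀ᵐ x ∂(surfaceMeasure K), x ∈ frontier (K : Set (E n)) :=
  ae_restrict_mem isClosed_frontier.measurableSet

lemma mem_steinerDomain_of_curvatureH_eq_zero {n : ℕ} {K : ConvexBody (E n)}
    (hK : K ∈ bodiesAroundOrigin n)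
    (h : ∀ᵐ x ∂(surfaceMeasure K), curvatureH K (n - 1) x = 0) : K ∈ steinerDomain n 1 :=
  ⟨hK, fun m k => (integrable_zero _ _ _).congr
    (h.mono fun _ hx => (steinerIntegrand_eq_zero hx m k).symm)⟩

lemma steinerW_eq_zero_of_curvatureH_eq_zero {n : ℕ} {K : ConvexBody (E n)}
    (h : ∀ᵐ x ∂(surfaceMeasure K), curvatureH K (n - 1) x = 0) (m k : ℕ) :
    steinerW 1 m k K = 0 :=
  integral_eq_zero_of_ae (h.mono fun _ hx => steinerIntegrand_eq_zero hx m k)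

lemma nullSingletonClass_euclideanHausdorffMeasure (n : ℕ) {d : ℕ} (hd : 1 ≤ d) :
    NullSingletonClass (Measure.euclideanHausdorffMeasure d : Measure (E n)) := by
  have := Measure.nullSingletonClass_hausdorff (E n) (d := (d : ℝ)) (by positivity)
  refine ⟨fun x => ?_⟩
  rw [Measure.euclideanHausdorffMeasure_def, Measure.smul_apply, measure_singleton, smul_zero]

/-- Polytopes are dense, and their Gauss curvature vanishes almost everywhere. -/
lemma exists_dist_le_curvatureH_eq_zero {n : ℕ} (hn : 2 ≤ n) {K : ConvexBody (E n)}
    (hK : K ∈ bodiesAroundOrigin n) {ε : ℝ} (hε : 0 < ε) :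
    ∃ P ∈ bodiesAroundOrigin n, dist P K ≤ ε ∧
      ∀ᵐ x ∂(surfaceMeasure P), curvatureH P (n - 1) x = 0 := by
  obtain ⟨t, hKt, htK⟩ := K.convex.exists_subset_interior_convexHull_finset_of_isCompact
    K.isCompact (Metric.thickening_mem_nhdsSet (K : Set (E n)) hε)
  have hKP : (K : Set (E n)) ⊆ convexHull ℝ (t : Set (E n)) := hKt.trans interior_subset
  let P : ConvexBody (E n) := ⟨convexHull ℝ (t : Set (E n)), convex_convexHull ℝ _,
    t.finite_toSet.isCompact_convexHull (𝕜 := ℝ), K.nonempty.mono hKP⟩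
  have hP : P ∈ bodiesAroundOrigin n := interior_mono hKP hK
  refine ⟨P, hP, ?_, ?_⟩
  · rw [← ConvexBody.hausdorffDist_coe]
    refine Metric.hausdorffDist_le_of_mem_dist hε.le (fun x hx => ?_) fun x hx =>
      ⟨x, hKP hx, by simpa using hε.le⟩
    obtain ⟨y, hy, hxy⟩ := Metric.mem_thickening_iff.1 (htK hx)
    exact ⟨y, hy, hxy.le⟩
  · have := nullSingletonClass_euclideanHausdorffMeasure n (d := n - 1) (by omega)
    -- Extreme points of the hull lie in the finite set `t`, which is null since `n - 1 ≥ 1`.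
    have hnull : surfaceMeasure P (t : Set (E n)) = 0 :=
      Measure.absolutelyContinuous_of_le Measure.restrict_le_self (t.finite_toSet.measure_zero _)
    filter_upwards [compl_mem_ae_iff.2 hnull, surfaceMeasure_ae_mem_frontier P] with x hxt hx
    have hxP : x ∈ P := P.isClosed.frontier_subset hx
    have hext : x ∉ (P : Set (E n)).extremePoints ℝ := fun h =>
      hxt (extremePoints_convexHull_subset (𝕜 := ℝ) h)
    obtain ⟨e, he, h₁, h₂⟩ := exists_segment_of_notMem_extremePoints P.convex hxP hext
    exact curvatureH_eq_zero_of_segment hn hP hx he h₁ h₂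

/-! ### Hausdorff measure estimates -/

lemma euclideanHausdorffMeasure_le_of_antilipschitz {X Y : Type*} [MetricSpace X]
    [MeasurableSpace X] [BorelSpace X] [MetricSpace Y] [MeasurableSpace Y] [BorelSpace Y]
    {f : X → Y} (hf : AntilipschitzWith 1 f) (d : ℕ) (s : Set X) :
    Measure.euclideanHausdorffMeasure d s ≤ Measure.euclideanHausdorffMeasure d (f '' s) := by
  have := hf.le_hausdorffMeasure_image (d := (d : ℝ)) (by positivity) s
  rw [ENNReal.coe_one, ENNReal.one_rpow, one_mul] at this
  rw [Measure.euclideanHausdorffMeasure_def, Measure.euclideanHausdorffMeasure_def,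
    Measure.smul_apply, Measure.smul_apply]
  gcongr

lemma euclideanHausdorffMeasure_image_le {X Y : Type*} [MetricSpace X]
    [MeasurableSpace X] [BorelSpace X] [MetricSpace Y] [MeasurableSpace Y] [BorelSpace Y]
    {f : X → Y} (hf : LipschitzWith 1 f) (d : ℕ) (s : Set X) :
    Measure.euclideanHausdorffMeasure d (f '' s) ≤ Measure.euclideanHausdorffMeasure d s := by
  have := hf.hausdorffMeasure_image_le (d := (d : ℝ)) (by positivity) s
  rw [ENNReal.coe_one, ENNReal.one_rpow, one_mul] at this
  rw [Measure.euclideanHausdorffMeasure_def, Measure.euclideanHausdorffMeasure_def,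
    Measure.smul_apply, Measure.smul_apply]
  gcongr

/-- The isometric embedding of `ℝᵈ` onto the hyperplane `{x | x i = c}` of `ℝᵈ⁺¹`. -/
noncomputable def hyperplaneEmbedding {d : ℕ} (i : Fin (d + 1)) (c : ℝ) (z : E d) : E (d + 1) :=
  WithLp.toLp 2 (i.insertNth c (WithLp.ofLp z))

lemma isometry_hyperplaneEmbedding {d : ℕ} (i : Fin (d + 1)) (c : ℝ) :
    Isometry (hyperplaneEmbedding i c) := by
  refine Isometry.of_dist_eq fun x y => ?_
  rw [EuclideanSpace.dist_eq, EuclideanSpace.dist_eq, Fin.sum_univ_succAbove _ i]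
  simp [hyperplaneEmbedding]

lemma norm_hyperplaneEmbedding_sq {d : ℕ} (i : Fin (d + 1)) (c : ℝ) (z : E d) :
    ‖hyperplaneEmbedding i c z‖ ^ 2 = c ^ 2 + ‖z‖ ^ 2 := by
  rw [EuclideanSpace.real_norm_sq_eq, EuclideanSpace.real_norm_sq_eq, Fin.sum_univ_succAbove _ i]
  simp [hyperplaneEmbedding]

lemma exists_hyperplaneEmbedding_eq {d : ℕ} (i : Fin (d + 1)) (x : E (d + 1)) :
    ∃ z, hyperplaneEmbedding i (x i) z = x := by
  refine ⟨WithLp.toLp 2 fun j => x (i.succAbove j), ?_⟩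
  ext j
  refine i.succAboveCases ?_ (fun j => ?_) j <;> simp [hyperplaneEmbedding]

lemma measure_hyperplane_inter_ball_lt_top {d : ℕ} (i : Fin (d + 1)) (c R : ℝ) :
    Measure.euclideanHausdorffMeasure d {x : E (d + 1) | x i = c ∧ ‖x‖ ≤ R} < ⊤ := by
  refine lt_of_le_of_lt (b := Measure.euclideanHausdorffMeasure d
    (hyperplaneEmbedding i c '' Metric.closedBall 0 R)) (measure_mono ?_) ?_
  · rintro x ⟨rfl, hx⟩
    obtain ⟨z, hz⟩ := exists_hyperplaneEmbedding_eq i x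
    refine ⟨z, ?_, hz⟩
    have := norm_hyperplaneEmbedding_sq i (x i) z
    rw [hz] at this
    rw [mem_closedBall_zero_iff]
    refine le_trans (abs_le_of_sq_le_sq' ?_ (norm_nonneg x)).2 hx
    nlinarith [sq_nonneg (x i)]
  · rw [(isometry_hyperplaneEmbedding i c).euclideanHausdorffMeasure_image,
      EuclideanSpace.euclideanHausdorffMeasure_eq_volume]
    exact measure_closedBall_lt_top

lemma measure_hyperplane_inter_sphere_eq_zero {d : ℕ} (hd : 1 ≤ d) (i : Fin (d + 1)) (c r : ℝ) :
    Measure.euclideanHausdorffMeasure d {x : E (d + 1) | x i = c ∧ ‖x‖ ^ 2 - x i ^ 2 = r} = 0 := by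
  refine measure_mono_null (t := hyperplaneEmbedding i c '' Metric.sphere 0 (√r)) ?_ ?_
  · rintro x ⟨rfl, hx⟩
    obtain ⟨z, hz⟩ := exists_hyperplaneEmbedding_eq i x
    refine ⟨z, ?_, hz⟩
    have := norm_hyperplaneEmbedding_sq i (x i) z
    rw [hz] at this
    rw [mem_sphere_zero_iff_norm, ← hx, this, add_sub_cancel_left, Real.sqrt_sq (norm_nonneg z)]
  · have : Nonempty (Fin d) := ⟨⟨0, hd⟩⟩
    rw [(isometry_hyperplaneEmbedding i c).euclideanHausdorffMeasure_image,
      EuclideanSpace.euclideanHausdorffMeasure_eq_volume]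
    exact Measure.addHaar_sphere _ _ _

/-- The surface area of a convex body is finite. -/
lemma isFiniteMeasure_surfaceMeasure {d : ℕ} {K : ConvexBody (E (d + 1))}
    (hK : K ∈ bodiesAroundOrigin (d + 1)) : IsFiniteMeasure (surfaceMeasure K) := by
  obtain ⟨R, hR⟩ := K.isBounded.exists_norm_le
  -- Each boundary point is pushed along its outer normal until some coordinate equals `±R`. The
  -- push does not shrink distances, so the surface area is at most the measure of `S`, a finite
  -- union of bounded pieces of hyperplanes.
  set S : Set (E (d + 1)) := ⋃ i : Fin (d + 1), ⋃ c : Bool,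
    {x | x i = (if c then R else -R) ∧ ‖x‖ ≤ R + 2 * R * (d + 1)} with hS
  have hSfin : Measure.euclideanHausdorffMeasure d S < ⊤ := by
    refine (measure_iUnion_fintype_le _ _).trans_lt (ENNReal.sum_lt_top.2 fun i _ => ?_)
    refine (measure_iUnion_fintype_le _ _).trans_lt (ENNReal.sum_lt_top.2 fun c _ => ?_)
    exact measure_hyperplane_inter_ball_lt_top i _ _
  have hex : ∀ x : frontier (K : Set (E (d + 1))), ∃ s : ℝ, 0 ≤ s ∧
      (x : E (d + 1)) + s • outerNormal K x ∈ S := by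
    rintro ⟨x, hx⟩
    have hN := isOuterUnitNormal_outerNormal hK hx
    have hxR : ‖x‖ ≤ R := hR x (K.isClosed.frontier_subset hx)
    have hR0 : 0 ≤ R := (norm_nonneg x).trans hxR
    set N := outerNormal K x
    -- Some coordinate of a unit vector is at least `1 / (d + 1)` in absolute value. A push changing
    -- that coordinate by at most `2R` has length at most `2R(d + 1)`, whence the radius in `S`.
    obtain ⟨i, hi⟩ : ∃ i, 1 ≤ (d + 1) * |N i| := by
      by_contra! h
      have h1 : ‖N‖ ^ 2 < 1 := by
        rw [EuclideanSpace.real_norm_sq_eq]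
        have hd : (0 : ℝ) < d + 1 := by positivity
        calc ∑ i, N i ^ 2 < ∑ _i : Fin (d + 1), (1 : ℝ) / (d + 1) := by
              refine Finset.sum_lt_sum_of_nonempty Finset.univ_nonempty fun i _ => ?_
              rw [lt_div_iff₀ hd, ← sq_abs]
              nlinarith [h i, abs_nonneg (N i), (Nat.cast_nonneg d : (0 : ℝ) ≤ d)]
          _ = 1 := by
              rw [Finset.sum_const, Finset.card_univ, Fintype.card_fin, nsmul_eq_mul]
              push_cast
              field_simp
      rw [hN.1] at h1
      norm_num at h1
    have hNi : 0 < |N i| := by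
      by_contra! h
      have : |N i| = 0 := le_antisymm h (abs_nonneg _)
      rw [this] at hi
      norm_num at hi
    have hxi : |x i| ≤ R := (by simpa using PiLp.norm_apply_le x i : |x i| ≤ ‖x‖).trans hxR
    have hxi' := abs_le.1 hxi
    have hbound : ∀ s, 0 ≤ s → s * |N i| ≤ 2 * R → ‖x + s • N‖ ≤ R + 2 * R * (d + 1) := by
      intro s hs hsN
      refine (norm_add_le _ _).trans (add_le_add hxR ?_)
      rw [norm_smul, hN.1, mul_one, Real.norm_of_nonneg hs]
      nlinarith [mul_le_mul_of_nonneg_left hi hs]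
    rcases lt_or_ge 0 (N i) with hpos | hneg
    · rw [abs_of_pos hpos] at hbound
      have hs : 0 ≤ (R - x i) / N i := div_nonneg (by linarith) hpos.le
      refine ⟨(R - x i) / N i, hs, Set.mem_iUnion.2 ⟨i, Set.mem_iUnion.2 ⟨true, ?_, ?_⟩⟩⟩
      · simp only [PiLp.add_apply, PiLp.smul_apply, smul_eq_mul, if_true]
        field_simp
        ring
      · refine hbound _ hs ?_
        rw [div_mul_cancel₀ _ hpos.ne']
        linarith
    · have hne : N i ≠ 0 := abs_pos.1 hNi
      have hlt : N i < 0 := lt_of_le_of_ne hneg hne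
      rw [abs_of_neg hlt] at hbound
      have hs : 0 ≤ (-R - x i) / N i := div_nonneg_of_nonpos (by linarith) hlt.le
      refine ⟨(-R - x i) / N i, hs, Set.mem_iUnion.2 ⟨i, Set.mem_iUnion.2 ⟨false, ?_, ?_⟩⟩⟩
      · simp only [PiLp.add_apply, PiLp.smul_apply, smul_eq_mul, Bool.false_eq_true, if_false]
        field_simp
        ring
      · refine hbound _ hs ?_
        rw [mul_neg, div_mul_cancel₀ _ hne]
        linarith
  choose s hs hsS using hex
  have hanti : AntilipschitzWith 1 fun x : frontier (K : Set (E (d + 1))) =>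
      (x : E (d + 1)) + s x • outerNormal K x := by
    refine AntilipschitzWith.of_le_mul_dist fun x y => ?_
    rw [NNReal.coe_one, one_mul, Subtype.dist_eq, dist_eq_norm, dist_eq_norm]
    have hx := (isOuterUnitNormal_outerNormal hK x.2).2 y (K.isClosed.frontier_subset y.2)
    have hy := (isOuterUnitNormal_outerNormal hK y.2).2 x (K.isClosed.frontier_subset x.2)
    set a : E (d + 1) := x - y with ha
    set b : E (d + 1) := s x • outerNormal K x - s y • outerNormal K y with hb
    have hab : (x : E (d + 1)) + s x • outerNormal K x - (y + s y • outerNormal K y) = a + b := by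
      rw [ha, hb]; abel
    -- Normals are monotone: `⟪x - y, N x⟫ ≥ 0 ≥ ⟪x - y, N y⟫`. Hence `‖a + b‖ ≥ ‖a‖`.
    have hin : 0 ≤ inner ℝ a b := by
      rw [ha, hb, inner_sub_right, inner_smul_right, inner_smul_right, inner_sub_left,
        inner_sub_left]
      nlinarith [mul_nonneg (hs x) (sub_nonneg.2 hx), mul_nonneg (hs y) (sub_nonneg.2 hy)]
    rw [hab]
    refine (abs_le_of_sq_le_sq' ?_ (norm_nonneg _)).2
    rw [norm_add_sq_real]
    nlinarith [sq_nonneg ‖b‖]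
  refine ⟨?_⟩
  rw [surfaceMeasure, Measure.restrict_apply_univ]
  calc Measure.euclideanHausdorffMeasure d (frontier (K : Set (E (d + 1))))
      = Measure.euclideanHausdorffMeasure d
          (Set.univ : Set (frontier (K : Set (E (d + 1))))) := by
        have h := Isometry.euclideanHausdorffMeasure_image (d := d)
          (f := (Subtype.val : frontier (K : Set (E (d + 1))) → E (d + 1)))
          (fun _ _ => rfl) Set.univ
        rw [← h, Set.image_univ, Subtype.range_coe]
    _ ≤ _ := euclideanHausdorffMeasure_le_of_antilipschitz hanti d _
    _ ≤ Measure.euclideanHausdorffMeasure d S := measure_mono (by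
        rintro _ ⟨x, -, rfl⟩
        exact hsS x)
    _ < ⊤ := hSfin

/-- The orthogonal projection forgetting the last coordinate. -/
noncomputable def forgetLast {d : ℕ} (x : E (d + 1)) : E d :=
  WithLp.toLp 2 fun j => x j.castSucc

lemma lipschitzWith_forgetLast {d : ℕ} : LipschitzWith 1 (forgetLast (d := d)) := by
  refine LipschitzWith.of_dist_le_mul fun x y => ?_
  rw [NNReal.coe_one, one_mul, EuclideanSpace.dist_eq, EuclideanSpace.dist_eq,
    Fin.sum_univ_castSucc]
  refine Real.sqrt_le_sqrt ?_
  simp only [forgetLast]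
  linarith [sq_nonneg (dist (x (Fin.last d)) (y (Fin.last d)))]

lemma volume_slab_box {d : ℕ} (a b c : ℝ) (hc : 0 ≤ c) :
    volume {w : E (d + 1) | w 0 ∈ Set.Ioo a b ∧ ∀ j : Fin d, w j.succ ∈ Set.Icc (-c) c} =
      ENNReal.ofReal ((b - a) * (2 * c) ^ d) := by
  have h := (EuclideanSpace.volume_preserving_symm_measurableEquiv_toLp
    (Fin (d + 1))).measure_preimage_equiv
    (Set.univ.pi (Fin.cons (Set.Ioo a b) fun _ : Fin d => Set.Icc (-c) c))
  rw [volume_pi_pi, Fin.prod_univ_succ] at h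
  simp only [Fin.cons_zero, Fin.cons_succ, Real.volume_Ioo, Real.volume_Icc, Finset.prod_const,
    Finset.card_univ, Fintype.card_fin] at h
  rw [← ENNReal.ofReal_pow (by linarith), ← ENNReal.ofReal_mul' (pow_nonneg (by linarith) d)] at h
  convert h using 2
  · ext w
    simp [Fin.forall_fin_succ]
  · ring_nf

/-! ### Curvatures of a body that is locally a quadric -/

lemma eventually_comp_norm_lt {V : Type*} [NormedAddCommGroup V] {φ : ℝ → ℝ}
    (hφ : Continuous φ) {b : ℝ} (h : φ 0 < b) : ∀ᶠ v : V in 𝓝 0, φ ‖v‖ < b := by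
  have : Continuous fun v : V => φ ‖v‖ := hφ.comp continuous_norm
  refine this.continuousAt.eventually_lt_const ?_
  simpa using h

/-- Near the point `x`, the body `K` is the sublevel set of a quadratic polynomial with gradient
`2 g` at `x` and second order part `h ↦ ⟪Q h, h⟫`. -/
def IsLocallyQuadric {n : ℕ} (K : ConvexBody (E n)) (x g : E n) (Q : E n →L[ℝ] E n) : Prop :=
  ∃ ρ > 0, ∀ h : E n, ‖h‖ < ρ → (x + h ∈ K ↔ 2 * inner ℝ g h + inner ℝ (Q h) h ≤ 0)

/-- For small `s > 0` the linear term dominates at `s • h`, so `x + s • h` lies in `K`. -/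
lemma IsLocallyQuadric.inner_nonpos {n : ℕ} {K : ConvexBody (E n)} {x g : E n}
    {Q : E n →L[ℝ] E n} (hQ : IsLocallyQuadric K x g Q) {u : E n} (hu : IsOuterUnitNormal K x u)
    {h : E n} (hh : inner ℝ g h < 0) : inner ℝ h u ≤ 0 := by
  obtain ⟨ρ, hρ, hloc⟩ := hQ
  have h1 : Filter.Tendsto (fun s : ℝ => ‖s • h‖) (𝓝[>] 0) (𝓝 0) := by
    have : Continuous fun s : ℝ => ‖s • h‖ := by fun_prop
    have := this.tendsto 0
    rw [zero_smul, norm_zero] at this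
    exact this.mono_left nhdsWithin_le_nhds
  have h2 : Filter.Tendsto (fun s : ℝ => 2 * inner ℝ g h + s * inner ℝ (Q h) h) (𝓝[>] 0)
      (𝓝 (2 * inner ℝ g h)) := by
    have : Continuous fun s : ℝ => 2 * inner ℝ g h + s * inner ℝ (Q h) h := by fun_prop
    have := this.tendsto 0
    rw [zero_mul, add_zero] at this
    exact this.mono_left nhdsWithin_le_nhds
  obtain ⟨s, hs1, hs2, hs0⟩ := ((h1.eventually_lt_const hρ).and
    ((h2.eventually_lt_const (show 2 * inner ℝ g h < 0 by linarith)).and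
      self_mem_nhdsWithin)).exists
  have hs0 : 0 < s := hs0
  have hmem := (hloc _ hs1).2 (by
    simp only [map_smul, inner_smul_left, inner_smul_right, conj_trivial]
    nlinarith)
  have := hu.2 _ hmem
  rw [inner_add_left, inner_smul_left, conj_trivial] at this
  nlinarith

lemma IsLocallyQuadric.eq_of_isOuterUnitNormal {n : ℕ} {K : ConvexBody (E n)} {x g : E n}
    {Q : E n →L[ℝ] E n} (hQ : IsLocallyQuadric K x g Q) (hg : g ≠ 0) {u : E n}
    (hu : IsOuterUnitNormal K x u) : u = ‖g‖⁻¹ • g := by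
  have hgn : 0 < ‖g‖ := norm_pos_iff.2 hg
  set N := ‖g‖⁻¹ • g with hN
  have hNN : inner ℝ N N = 1 := by
    rw [real_inner_self_eq_norm_sq, hN, norm_smul, norm_inv, norm_norm,
      inv_mul_cancel₀ hgn.ne', one_pow]
  have hgN : g = ‖g‖ • N := by rw [hN, smul_smul, mul_inv_cancel₀ hgn.ne', one_smul]
  have huu : inner ℝ u u = 1 := by rw [real_inner_self_eq_norm_sq, hu.1, one_pow]
  set c := inner ℝ u N with hc
  have hcN : inner ℝ N u = c := real_inner_comm _ _
  have key : ∀ h, inner ℝ N h < 0 → inner ℝ h u ≤ 0 := fun h hh =>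
    hQ.inner_nonpos hu (by
      rw [hgN, inner_smul_left, conj_trivial]
      exact mul_neg_of_pos_of_neg hgn hh)
  have hc0 : 0 ≤ c := by
    have := key (-N) (by rw [inner_neg_right, hNN]; norm_num)
    rw [inner_neg_left, hcN] at this
    linarith
  -- The test vector is the part of `u` orthogonal to `N`, tilted inward by `η`; letting `η → 0`
  -- forces `c ^ 2 ≥ 1`.
  have hp : ∀ η > 0, 1 - c ^ 2 ≤ η * c := fun η hη => by
    have := key (u - c • N - η • N) (by
      simp only [inner_sub_right, inner_smul_right, hNN, hcN]
      linarith)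
    simp only [inner_sub_left, inner_smul_left, conj_trivial, huu, hcN] at this
    nlinarith
  have hc1 : 1 - c ^ 2 ≤ 0 := by
    refine le_of_forall_pos_le_add fun δ hδ => ?_
    refine (hp (δ / (c + 1)) (by positivity)).trans ?_
    rw [zero_add, div_mul_eq_mul_div, div_le_iff₀ (by positivity)]
    nlinarith
  have : c = 1 := le_antisymm (by
    have := real_inner_le_norm u N
    rw [hu.1, ← Real.sqrt_sq (norm_nonneg N), ← real_inner_self_eq_norm_sq, hNN] at this
    simpa using this) (by nlinarith)
  rw [← sub_eq_zero, ← inner_self_eq_zero (𝕜 := ℝ)]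
  simp only [inner_sub_left, inner_sub_right, huu, hNN, hcN, ← hc, this]
  norm_num

/-- With `w = ‖g‖` and `q = ⟪Q v, v⟫`, the boundary height `s` solves `-2ws + q + O(‖v‖ s + s²) =
0`, so `s = q / (2w) + o(‖v‖²)`. The proof compares it with the heights `q / (2w) ± c‖v‖²`. -/
lemma IsLocallyQuadric.isWeingartenMap {n : ℕ} {K : ConvexBody (E n)} {x g : E n}
    {Q : E n →L[ℝ] E n} (hQ : IsLocallyQuadric K x g Q) (hg : g ≠ 0)
    (hQsym : ∀ a b, inner ℝ (Q a) b = inner ℝ (Q b) a) (hQpos : ∀ a, 0 ≤ inner ℝ (Q a) a)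
    (hN : IsOuterUnitNormal K x (outerNormal K x))
    {A : tangentSpace K x →ₗ[ℝ] tangentSpace K x} (hA : A.IsSymmetric)
    (hAQ : ∀ v, inner ℝ (A v) v = inner ℝ (Q v) (v : E n) / ‖g‖) : IsWeingartenMap K x A := by
  refine ⟨hA, isLittleO_iff.2 fun c hc => ?_⟩
  have hu := hQ.eq_of_isOuterUnitNormal hg hN
  obtain ⟨ρ, hρ, hloc⟩ := hQ
  set w := ‖g‖ with hw
  have hw0 : 0 < w := norm_pos_iff.2 hg
  set u := outerNormal K x with hu_def
  set M := ‖Q‖ with hM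
  have hM0 : 0 ≤ M := norm_nonneg Q
  -- `D‖v‖²` bounds the heights under comparison. Below, `e1` keeps them in the range of the local
  -- description, and `e2` makes the terms with `⟪Q v, u⟫` and `⟪Q u, u⟫` smaller than the margin
  -- `2wc‖v‖²`.
  set D := M / (2 * w) + c with hD
  have hD0 : 0 < D := by positivity
  have hgu : g = w • u := by rw [hu, smul_smul, mul_inv_cancel₀ hw0.ne', one_smul]
  have hquad : ∀ a, inner ℝ (Q a) a ≤ M * ‖a‖ ^ 2 := fun a =>
    (real_inner_le_norm _ _).trans (by
      nlinarith [Q.le_opNorm a, norm_nonneg a])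
  have hmem : ∀ (v : tangentSpace K x) (s : ℝ), ‖(v : E n) - s • u‖ < ρ →
      (x + (v : E n) - s • u ∈ K ↔ -2 * w * s + inner ℝ (Q v) (v : E n)
        - 2 * s * inner ℝ (Q v) u + s ^ 2 * inner ℝ (Q u) u ≤ 0) := by
    intro v s hs
    rw [add_sub_assoc, hloc _ hs]
    have h1 : inner ℝ u (v : E n) = 0 := by
      rw [real_inner_comm]; exact mem_tangentSpace_iff.1 v.2
    have h2 : inner ℝ u u = 1 := by rw [real_inner_self_eq_norm_sq, hN.1, one_pow]
    have h3 : 2 * inner ℝ g ((v : E n) - s • u) + inner ℝ (Q (v - s • u)) ((v : E n) - s • u)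
        = -2 * w * s + inner ℝ (Q v) (v : E n)
        - 2 * s * inner ℝ (Q v) u + s ^ 2 * inner ℝ (Q u) u := by
      rw [hgu]
      simp only [map_sub, map_smul, inner_sub_left, inner_sub_right, inner_smul_left,
        inner_smul_right, conj_trivial, h1, h2, hQsym u v]
      ring
    rw [h3]
  have e1 : ∀ᶠ v : tangentSpace K x in 𝓝 0, ‖v‖ + D * ‖v‖ ^ 2 < ρ :=
    eventually_comp_norm_lt (φ := fun r => r + D * r ^ 2) (by fun_prop) (by simpa using hρ)
  have e2 : ∀ᶠ v : tangentSpace K x in 𝓝 0,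
      2 * D * M * ‖v‖ + D ^ 2 * M * ‖v‖ ^ 2 < 2 * w * c :=
    eventually_comp_norm_lt (φ := fun r => 2 * D * M * r + D ^ 2 * M * r ^ 2) (by fun_prop)
      (by simpa using (by positivity : 0 < 2 * w * c))
  filter_upwards [e1, e2] with v h1 h2
  set r := ‖v‖ with hr
  have hr0 : 0 ≤ r := norm_nonneg v
  set q := inner ℝ (Q v) (v : E n) with hq
  have hq0 : 0 ≤ q := hQpos v
  have hqM : q ≤ M * r ^ 2 := hquad v
  have hQvu : |inner ℝ (Q v) u| ≤ M * r := by
    refine (abs_real_inner_le_norm _ _).trans ?_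
    rw [hN.1, mul_one]
    exact Q.le_opNorm v
  have hQvu' := abs_le.1 hQvu
  have hQuu0 : 0 ≤ inner ℝ (Q u) u := hQpos u
  have hQuu : inner ℝ (Q u) u ≤ M := by simpa [hN.1] using hquad u
  have hq2 : q / (2 * w) ≤ M / (2 * w) * r ^ 2 := by
    rw [div_mul_eq_mul_div]; gcongr
  have hrange : ∀ s, 0 ≤ s → s ≤ D * r ^ 2 → ‖(v : E n) - s • u‖ < ρ := fun s hs hsD => by
    refine ((norm_sub_le _ _).trans ?_).trans_lt h1
    rw [norm_smul, hN.1, mul_one, Real.norm_of_nonneg hs]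
    exact add_le_add le_rfl hsD
  have hqw : 2 * w * (q / (2 * w)) = q := by field_simp
  have hcross : ∀ s, 0 ≤ s → s ≤ D * r ^ 2 → |s * inner ℝ (Q v) u| ≤ D * r ^ 2 * (M * r) :=
    fun s hs hsD => by
      rw [abs_mul, abs_of_nonneg hs]
      exact mul_le_mul hsD hQvu (abs_nonneg _) (by positivity)
  have h3 := mul_le_mul_of_nonneg_right h2.le (sq_nonneg r)
  have hs0 : 0 ≤ q / (2 * w) + c * r ^ 2 := by positivity
  have hsK : x + (v : E n) - (q / (2 * w) + c * r ^ 2) • u ∈ K := by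
    have hsD : q / (2 * w) + c * r ^ 2 ≤ D * r ^ 2 := by rw [hD, add_mul]; linarith
    have a3 : -2 * w * (q / (2 * w) + c * r ^ 2) + q = -(2 * w * c) * r ^ 2 := by
      rw [mul_add]; linarith
    rw [hmem v _ (hrange _ hs0 hsD)]
    generalize q / (2 * w) + c * r ^ 2 = s at hs0 hsD a3
    have a1 := (abs_le.1 (hcross s hs0 hsD)).1
    have a2 : s ^ 2 * inner ℝ (Q u) u ≤ (D * r ^ 2) ^ 2 * M := by gcongr
    nlinarith
  have hup : boundaryFunction K x v ≤ q / (2 * w) + c * r ^ 2 := boundaryFunction_le hN v hsK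
  have hlow : q / (2 * w) - c * r ^ 2 ≤ boundaryFunction K x v := by
    refine le_csInf ⟨_, hsK⟩ fun s hs => ?_
    have hs0 : 0 ≤ s := nonneg_of_sub_smul_mem hN v hs
    by_contra! hlt
    have hsD : s ≤ D * r ^ 2 := by
      rw [hD, add_mul]; nlinarith [mul_nonneg hc.le (sq_nonneg r)]
    have a0 := (hmem v s (hrange s hs0 hsD)).1 hs
    have a1 := (abs_le.1 (hcross s hs0 hsD)).2
    have a2 : 0 ≤ s ^ 2 * inner ℝ (Q u) u := by positivity
    have a3 : 2 * w * s < q - 2 * w * c * r ^ 2 := by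
      have := mul_lt_mul_of_pos_left hlt (show 0 < 2 * w by positivity)
      rw [mul_sub, hqw] at this
      linarith
    have a4 : 0 ≤ D ^ 2 * M * r ^ 2 * r ^ 2 := by positivity
    nlinarith
  rw [hAQ, Real.norm_eq_abs, norm_pow, norm_norm, abs_le]
  have : q / w / 2 = q / (2 * w) := by rw [div_div, mul_comm]
  rw [this]
  constructor <;> linarith

open Polynomial in
-- A rank-one operator has characteristic polynomial `X ^ (m - 1) * (X - f v)`; adding `a • id`
-- shifts the variable by `a`.
lemma charpoly_smul_id_add_smulRight {V : Type*} [AddCommGroup V] [Module ℝ V]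
    [FiniteDimensional ℝ V] (hV : 0 < Module.finrank ℝ V) (a : ℝ) (f : Module.Dual ℝ V) (v : V) :
    (a • LinearMap.id + f.smulRight v : V →ₗ[ℝ] V).charpoly =
      (X - C a) ^ (Module.finrank ℝ V - 1) * (X - C (a + f v)) := by
  let b := Module.finBasis ℝ V
  set m := Module.finrank ℝ V
  set N := Matrix.vecMulVec (b.repr v) fun j => f (b j)
  have hM : LinearMap.toMatrix b b (a • LinearMap.id + f.smulRight v)
      = N - Matrix.scalar (Fin m) (-a) := by
    ext i j
    simp [N, LinearMap.toMatrix_apply, Matrix.vecMulVec_apply,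
      Finsupp.single_apply, Matrix.diagonal_apply, mul_comm, eq_comm]
    split_ifs <;> ring
  have hdot : (b.repr v : Fin m → ℝ) ⬝ᵥ (fun j => f (b j)) = f v := by
    conv_rhs => rw [← b.sum_repr v]
    rw [map_sum]
    simp only [map_smul, smul_eq_mul, dotProduct]
  rw [← LinearMap.charpoly_toMatrix _ b, hM, Matrix.charpoly_sub_scalar,
    Matrix.charpoly_vecMulVec, hdot, Fintype.card_fin]
  obtain ⟨m', hm'⟩ : ∃ m', m = m' + 1 := ⟨m - 1, by omega⟩
  rw [hm', Nat.add_sub_cancel, smul_eq_C_mul]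
  simp only [sub_comp, mul_comp, pow_comp, X_comp, C_comp, map_neg, map_add]
  ring

/-- The operator `h ↦ h + (l - 1) ⟪e, h⟫ e`, which stretches the direction `e` by the factor `l`. -/
noncomputable def stretch {n : ℕ} (e : E n) (l : ℝ) : E n →L[ℝ] E n :=
  ContinuousLinearMap.id ℝ (E n) + (l - 1) • (innerSL ℝ e).smulRight e

lemma stretch_apply {n : ℕ} (e : E n) (l : ℝ) (h : E n) :
    stretch e l h = h + ((l - 1) * inner ℝ e h) • e := by
  simp [stretch, smul_smul]

lemma inner_stretch {n : ℕ} (e : E n) (l : ℝ) (a b : E n) :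
    inner ℝ (stretch e l a) b = inner ℝ a b + (l - 1) * inner ℝ e a * inner ℝ e b := by
  rw [stretch_apply, inner_add_left, inner_smul_left, conj_trivial]

/-- The principal curvatures of a body that is locally an ellipsoid of revolution. -/
lemma IsLocallyQuadric.principalCurvatures_eq {n : ℕ} (hn : 2 ≤ n) {K : ConvexBody (E n)}
    {x g e : E n} {l : ℝ} (he : ‖e‖ = 1) (hl : 1 ≤ l)
    (hQ : IsLocallyQuadric K x g (stretch e l)) (hg : g ≠ 0)
    (hN : IsOuterUnitNormal K x (outerNormal K x)) :
    principalCurvatures K x =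
      (‖g‖⁻¹ * (1 + (l - 1) * (1 - inner ℝ e (outerNormal K x) ^ 2))) ::ₘ
        Multiset.replicate (n - 2) ‖g‖⁻¹ := by
  have hgn : 0 < ‖g‖ := norm_pos_iff.2 hg
  set u := outerNormal K x with hu
  have hee : inner ℝ e e = 1 := by rw [real_inner_self_eq_norm_sq, he, one_pow]
  have huu : inner ℝ u u = 1 := by rw [real_inner_self_eq_norm_sq, hN.1, one_pow]
  -- This is the projection of `e` to the tangent hyperplane. Compressed there, the stretch is the
  -- identity plus a rank-one operator along `p`, and `⟪e, p⟫ = 1 - ⟪e, u⟫²` gives the exceptional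
  -- eigenvalue.
  let p : tangentSpace K x := ⟨e - inner ℝ e u • u, mem_tangentSpace_iff.2 (by
    rw [← hu, inner_sub_left, inner_smul_left, huu, conj_trivial, mul_one, sub_self])⟩
  have hp : ∀ v : tangentSpace K x, inner ℝ p v = inner ℝ e (v : E n) := fun v => by
    have : inner ℝ u (v : E n) = 0 := by
      rw [real_inner_comm]; exact mem_tangentSpace_iff.1 v.2
    rw [Submodule.coe_inner, inner_sub_left, inner_smul_left, this, mul_zero, sub_zero]
  let f : Module.Dual ℝ (tangentSpace K x) := (‖g‖⁻¹ * (l - 1)) • (innerₗ (tangentSpace K x) p)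
  have hf : ∀ v, f v = ‖g‖⁻¹ * (l - 1) * inner ℝ e (v : E n) := fun v => by
    rw [← hp]; rfl
  let A : tangentSpace K x →ₗ[ℝ] tangentSpace K x := ‖g‖⁻¹ • LinearMap.id + f.smulRight p
  have hAin : ∀ v v', inner ℝ (A v) v' = inner ℝ (stretch e l v) (v' : E n) / ‖g‖ := fun v v' => by
    have : A v = ‖g‖⁻¹ • v + f v • p := rfl
    rw [this, inner_add_left, inner_smul_left, inner_smul_left, hp, hf, inner_stretch,
      Submodule.coe_inner, conj_trivial, conj_trivial]
    field_simp
  have hsym : ∀ a b, inner ℝ (stretch e l a) b = inner ℝ (stretch e l b) a := fun a b => by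
    rw [inner_stretch, inner_stretch, real_inner_comm]; ring
  have hpos : ∀ a, 0 ≤ inner ℝ (stretch e l a) a := fun a => by
    rw [inner_stretch, mul_assoc]
    exact add_nonneg real_inner_self_nonneg
      (mul_nonneg (by linarith) (mul_self_nonneg _))
  have hA : IsWeingartenMap K x A := by
    refine hQ.isWeingartenMap hg hsym hpos hN (fun v v' => ?_) fun v => hAin v v
    rw [hAin, hsym, ← hAin, real_inner_comm]
  have hrank := finrank_tangentSpace hN
  rw [LpSteiner.principalCurvatures_eq hA, charpoly_smul_id_add_smulRight (by omega), hrank,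
    Polynomial.roots_mul (mul_ne_zero (pow_ne_zero _ (Polynomial.X_sub_C_ne_zero _))
      (Polynomial.X_sub_C_ne_zero _)), Polynomial.roots_pow, Polynomial.roots_X_sub_C,
    Polynomial.roots_X_sub_C, add_comm, Multiset.nsmul_singleton, Multiset.singleton_add,
    Nat.sub_sub, hf]
  congr 1
  have : inner ℝ e (p : E n) = 1 - inner ℝ e u ^ 2 := by
    rw [inner_sub_right, inner_smul_right, hee, sq]
  rw [this]
  ring

/-! ### Elementary symmetric functions -/

lemma esymm_cons_succ (a : ℝ) (s : Multiset ℝ) (j : ℕ) :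
    (a ::ₘ s).esymm (j + 1) = s.esymm (j + 1) + a * s.esymm j := by
  simp only [Multiset.esymm, Multiset.powersetCard_cons, Multiset.map_add, Multiset.sum_add,
    Multiset.map_map, Function.comp_def, Multiset.prod_cons, Multiset.sum_map_mul_left]

lemma esymm_replicate (b : ℝ) (d j : ℕ) :
    (Multiset.replicate d b).esymm j = d.choose j * b ^ j := by
  induction d generalizing j with
  | zero =>
    cases j with
    | zero => simp [Multiset.esymm]
    | succ j =>
      rw [Multiset.replicate_zero, Multiset.esymm, Multiset.powersetCard_eq_empty _ (by simp)]
      simp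
  | succ d ih =>
    cases j with
    | zero => simp [Multiset.esymm]
    | succ j =>
      rw [Multiset.replicate_succ, esymm_cons_succ, ih, ih, Nat.choose_succ_succ]
      push_cast
      ring

lemma esymm_cons_replicate (a b : ℝ) (d j : ℕ) :
    (a ::ₘ Multiset.replicate d b).esymm (j + 1) =
      d.choose (j + 1) * b ^ (j + 1) + a * (d.choose j * b ^ j) := by
  rw [esymm_cons_succ, esymm_replicate, esymm_replicate]

/-! ### The dominant term of the Steiner integrand -/

/-- No factor of `a(a - 1)⋯(a - k + 1)` vanishes, as `a` is not an integer. -/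
lemma ringChoose_ne_zero {a : ℝ} (h0 : 0 < a) (h1 : a < 1) (k : ℕ) : Ring.choose a k ≠ 0 := by
  intro h
  have h2 := Ring.descPochhammer_eq_factorial_smul_choose a k
  rw [h, smul_zero] at h2
  have h3 : ∀ k : ℕ, (descPochhammer ℤ k).smeval a ≠ 0 := fun k => by
    induction k with
    | zero => simp
    | succ k ih =>
      rw [descPochhammer_succ_right, Polynomial.smeval_mul, Polynomial.smeval_sub,
        Polynomial.smeval_X, Polynomial.smeval_natCast, pow_one, pow_zero, nsmul_one]
      refine mul_ne_zero ih fun h => ?_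
      rcases k with _ | k
      · simp at h; linarith
      · push_cast at h
        linarith [(Nat.cast_nonneg k : (0 : ℝ) ≤ k)]
  exact h3 k h2

/-- The sum in the `L_1` Steiner integrand, as a polynomial in the unnormalized elementary
symmetric functions of the principal curvatures. -/
noncomputable def steinerPolynomial (n m : ℕ) (h : Fin (n - 1) → ℝ) : ℝ :=
  ∑ i ∈ indexSequences n m, coeffC n 1 i * ∏ j, h j ^ i j

/-- The bound `i j ≤ m` built into the definition follows from the weighted sum. -/
lemma mem_indexSequences {n m : ℕ} {i : Fin (n - 1) → ℕ} :
    i ∈ indexSequences n m ↔ ∑ j : Fin (n - 1), ((j : ℕ) + 1) * i j = m := by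
  rw [indexSequences, Finset.mem_filter, Fintype.mem_piFinset]
  refine ⟨fun h => h.2, fun h => ⟨fun j => ?_, h⟩⟩
  have := Finset.single_le_sum (f := fun j : Fin (n - 1) => ((j : ℕ) + 1) * i j)
    (fun _ _ => Nat.zero_le _) (Finset.mem_univ j)
  rw [Finset.mem_range]
  simp only [h] at this
  nlinarith [Nat.zero_le ((j : ℕ) * i j)]

/-- Zero-based, `m = ∑ i j + ∑ j * i j`, so total degree `m` leaves no weight at positive indices.
-/
lemma sum_lt_of_mem_indexSequences {n m : ℕ} (j₀ : Fin (n - 1)) (hj₀ : (j₀ : ℕ) = 0)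
    {i : Fin (n - 1) → ℕ} (hi : i ∈ indexSequences n m) (hne : i ≠ Pi.single j₀ m) :
    ∑ j, i j < m := by
  rw [mem_indexSequences] at hi
  have hsum : ∑ j, i j + ∑ j : Fin (n - 1), (j : ℕ) * i j = m := by
    rw [← hi, ← Finset.sum_add_distrib]
    exact Finset.sum_congr rfl fun _ _ => by ring
  by_contra! hle
  have h0 : ∑ j : Fin (n - 1), (j : ℕ) * i j = 0 := by omega
  have hz : ∀ j, j ≠ j₀ → i j = 0 := fun j hj => by
    have := (Finset.sum_eq_zero_iff.1 h0) j (Finset.mem_univ j)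
    rcases mul_eq_zero.1 this with h | h
    · exact absurd (Fin.ext (h.trans hj₀.symm)) hj
    · exact h
  refine hne (funext fun j => ?_)
  by_cases hj : j = j₀
  · subst hj
    rw [Pi.single_eq_same]
    rw [h0, add_zero, Finset.sum_eq_single j (fun b _ hb => hz b hb) (by simp)] at hsum
    exact hsum
  · rw [hz j hj, Pi.single_eq_of_ne hj]

lemma single_mem_indexSequences {n m : ℕ} (j₀ : Fin (n - 1)) (hj₀ : (j₀ : ℕ) = 0) :
    Pi.single j₀ m ∈ indexSequences n m := by
  rw [mem_indexSequences, Finset.sum_eq_single j₀ (fun b _ hb => by simp [hb]) (by simp), hj₀]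
  simp

lemma coeffC_single {n m : ℕ} (p : ℝ) (j₀ : Fin (n - 1)) :
    coeffC n p (Pi.single j₀ m) = Ring.choose ((n : ℝ) / (n + p)) m := by
  have hsum : ∑ j, (Pi.single j₀ m : Fin (n - 1) → ℕ) j = m := by simp
  have hprod : ∏ j, ((Pi.single j₀ m : Fin (n - 1) → ℕ) j).factorial = m.factorial := by
    rw [Finset.prod_eq_single j₀ (fun b _ hb => by simp [hb]) (by simp), Pi.single_eq_same]
  have h := Nat.multinomial_spec Finset.univ (Pi.single j₀ m : Fin (n - 1) → ℕ)
  rw [hsum, hprod] at h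
  have h1 := Nat.eq_of_mul_eq_mul_left (Nat.factorial_pos m) (h.trans (mul_one _).symm)
  rw [coeffC, hsum, h1, Nat.cast_one, mul_one]

/-- All monomials other than `h j₀ ^ k` have total degree at most `k - 1`. The bound `T` is common
to all `h j` because a single large curvature enters each elementary symmetric function only
linearly. -/
lemma abs_steinerPolynomial_sub_le (n k : ℕ) (j₀ : Fin (n - 1)) (hj₀ : (j₀ : ℕ) = 0) :
    ∃ M, 0 ≤ M ∧ ∀ T, 1 ≤ T → ∀ h : Fin (n - 1) → ℝ, (∀ j, |h j| ≤ T) →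
      |steinerPolynomial n k h - Ring.choose ((n : ℝ) / (n + 1)) k * h j₀ ^ k| ≤
        M * T ^ (k - 1) := by
  refine ⟨∑ i ∈ (indexSequences n k).erase (Pi.single j₀ k), |coeffC n 1 i|,
    Finset.sum_nonneg fun _ _ => abs_nonneg _, fun T hT h hh => ?_⟩
  rw [steinerPolynomial, ← Finset.add_sum_erase _ _ (single_mem_indexSequences (m := k) j₀ hj₀),
    coeffC_single,
    Finset.prod_eq_single j₀ (fun b _ hb => by simp [hb]) (by simp), Pi.single_eq_same,
    add_sub_cancel_left, Finset.sum_mul]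
  refine (Finset.abs_sum_le_sum_abs _ _).trans (Finset.sum_le_sum fun i hi => ?_)
  rw [Finset.mem_erase] at hi
  rw [abs_mul, Finset.abs_prod]
  refine mul_le_mul_of_nonneg_left ?_ (abs_nonneg _)
  calc ∏ j, |h j ^ i j| ≤ ∏ j, T ^ i j :=
        Finset.prod_le_prod (fun _ _ => abs_nonneg _) fun j _ => by
          rw [abs_pow]; exact pow_le_pow_left₀ (abs_nonneg _) (hh j) _
    _ = T ^ ∑ j, i j := Finset.prod_pow_eq_pow_sum _ _ _
    _ ≤ T ^ (k - 1) :=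
        pow_le_pow_right₀ hT (Nat.le_sub_one_of_lt (sum_lt_of_mem_indexSequences j₀ hj₀ hi.2 hi.1))

lemma exists_le_sign_mul_steinerPolynomial {n k : ℕ} (hn : 2 ≤ n) (hk : 1 ≤ k)
    (j₀ : Fin (n - 1)) (hj₀ : (j₀ : ℕ) = 0) {B : ℝ} (hB : 1 ≤ B) :
    ∃ σ c l₀ : ℝ, (σ = 1 ∨ σ = -1) ∧ 0 < c ∧ ∀ l, 1 ≤ l → l₀ ≤ l → ∀ h : Fin (n - 1) → ℝ,
      (∀ j, |h j| ≤ B * l) → l / B ≤ h j₀ → c * l ^ k ≤ σ * steinerPolynomial n k h := by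
  obtain ⟨M, hM, hS⟩ := abs_steinerPolynomial_sub_le n k j₀ hj₀
  have hn' : (2 : ℝ) ≤ n := by exact_mod_cast hn
  have hC : Ring.choose ((n : ℝ) / (n + 1)) k ≠ 0 :=
    ringChoose_ne_zero (by positivity) (by rw [div_lt_one (by positivity)]; linarith) k
  set C := Ring.choose ((n : ℝ) / (n + 1)) k
  obtain ⟨σ, hσ, hσC⟩ : ∃ σ : ℝ, (σ = 1 ∨ σ = -1) ∧ σ * C = |C| := by
    rcases lt_or_gt_of_ne hC with h | h
    · exact ⟨-1, Or.inr rfl, by rw [abs_of_neg h]; ring⟩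
    · exact ⟨1, Or.inl rfl, by rw [abs_of_pos h]; ring⟩
  have hC' : 0 < |C| := abs_pos.2 hC
  -- The main term is at least `|C| (l / B) ^ k`. The constant keeps half of it, and from `l₀` on
  -- the error `M (B l) ^ (k - 1)` is at most the other half.
  refine ⟨σ, |C| / (2 * B ^ k), 2 * M * B ^ (k - 1) * B ^ k / |C|, hσ, by positivity,
    fun l hl hl₀ h hh hh₀ => ?_⟩
  have h1 := hS (B * l) (by nlinarith) h hh
  have h2 : |σ| = 1 := by rcases hσ with rfl | rfl <;> simp
  have h3 : |σ * steinerPolynomial n k h - |C| * h j₀ ^ k| ≤ M * (B * l) ^ (k - 1) := by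
    rw [← hσC, mul_assoc, ← mul_sub, abs_mul, h2, one_mul]
    exact h1
  have h4 : |C| * (l / B) ^ k ≤ |C| * h j₀ ^ k := by gcongr
  have h5 : M * (B * l) ^ (k - 1) ≤ |C| / (2 * B ^ k) * l ^ k := by
    rw [div_le_iff₀ hC'] at hl₀
    have e : l ^ k = l * l ^ (k - 1) := by
      rw [← pow_succ', Nat.sub_add_cancel hk]
    rw [e, mul_pow, div_mul_eq_mul_div, le_div_iff₀ (by positivity)]
    nlinarith [mul_le_mul_of_nonneg_right hl₀ (by positivity : 0 ≤ l ^ (k - 1))]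
  have h6 : |C| * (l / B) ^ k = 2 * (|C| / (2 * B ^ k) * l ^ k) := by
    rw [div_pow]; field_simp
  linarith [(abs_le.1 h3).1]

lemma steinerIntegrand_one_eq {n : ℕ} (m k : ℕ) (K : ConvexBody (E n)) (x : E n) :
    steinerIntegrand 1 m k K x =
      (inner ℝ x (outerNormal K x)) ^ ((m : ℝ) - k) *
        curvatureH K (n - 1) x ^ ((1 : ℝ) / (n + 1)) *
        steinerPolynomial n m fun j => (principalCurvatures K x).esymm ((j : ℕ) + 1) := by
  rw [steinerIntegrand, steinerPolynomial, sub_self, mul_zero, zero_div, add_zero]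
  congr 1
  refine Finset.sum_congr rfl fun i _ => ?_
  congr 1
  refine Finset.prod_congr rfl fun j _ => ?_
  have : ((n - 1).choose ((j : ℕ) + 1) : ℝ) ≠ 0 := by
    exact_mod_cast (Nat.choose_pos j.2).ne'
  rw [← mul_pow, curvatureH, mul_div_cancel₀ _ this]

lemma steinerV_one_eq {n : ℕ} (k : ℕ) (K : ConvexBody (E n)) :
    steinerV 1 k K = steinerW 1 k k K := by
  rw [steinerV, Finset.sum_eq_single k]
  · simp
  · intro m hm hmk
    have : k - m ≠ 0 := by
      have := Finset.mem_range.1 hm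
      omega
    rw [sub_self, mul_zero, zero_div, Ring.choose_zero_ite, if_neg this, zero_mul]
  · simp

/-! ### A cylinder with a rim that is part of an ellipsoid -/

/-- The first vector of the standard basis. -/
noncomputable def axis (d : ℕ) : E (d + 2) := EuclideanSpace.single 0 1

lemma norm_axis (d : ℕ) : ‖axis d‖ = 1 := by simp [axis]

lemma inner_axis {d : ℕ} (x : E (d + 2)) : inner ℝ (axis d) x = x 0 := by
  simp [axis, EuclideanSpace.inner_single_left]

lemma inner_axis_right {d : ℕ} (x : E (d + 2)) : inner ℝ x (axis d) = x 0 := by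
  rw [real_inner_comm, inner_axis]

lemma axis_zero (d : ℕ) : axis d 0 = 1 := by simp [axis]

/-- The squared distance to the axis, plus `l` times the squared height above level `1`. -/
noncomputable def rimFunction {d : ℕ} (l : ℝ) (x : E (d + 2)) : ℝ :=
  ‖x‖ ^ 2 - x 0 ^ 2 + l * max (x 0 - 1) 0 ^ 2

lemma norm_sub_axis_sq {d : ℕ} (x : E (d + 2)) (a : ℝ) :
    ‖x - a • axis d‖ ^ 2 = ‖x‖ ^ 2 - 2 * a * x 0 + a ^ 2 := by
  rw [norm_sub_sq_real, inner_smul_right, real_inner_comm, inner_axis, norm_smul, norm_axis,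
    mul_one, Real.norm_eq_abs, sq_abs]
  ring

lemma continuous_rimFunction {d : ℕ} (l : ℝ) : Continuous (rimFunction (d := d) l) := by
  unfold rimFunction
  fun_prop

/-- It is a nonnegative combination of squares of two nonnegative convex functions: the distance to
the axis and the excess height. -/
lemma convexOn_rimFunction {d : ℕ} {l : ℝ} (hl : 0 ≤ l) :
    ConvexOn ℝ Set.univ (rimFunction (d := d) l) := by
  have h1 : ConvexOn ℝ Set.univ fun x : E (d + 2) => ‖x - x 0 • axis d‖ := by
    refine ⟨convex_univ, fun x _ y _ a b ha hb _ => ?_⟩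
    have : a • x + b • y - (a • x + b • y) 0 • axis d
        = a • (x - x 0 • axis d) + b • (y - y 0 • axis d) := by
      simp only [PiLp.add_apply, PiLp.smul_apply, smul_eq_mul]
      module
    dsimp only
    rw [this]
    refine (norm_add_le _ _).trans (le_of_eq ?_)
    rw [norm_smul, norm_smul, Real.norm_of_nonneg ha, Real.norm_of_nonneg hb, smul_eq_mul,
      smul_eq_mul]
  have h2 : ConvexOn ℝ Set.univ fun x : E (d + 2) => max (x 0 - 1) 0 := by
    refine ConvexOn.sup ⟨convex_univ, fun x _ y _ a b ha hb hab => le_of_eq ?_⟩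
      (convexOn_const _ convex_univ)
    simp only [PiLp.add_apply, PiLp.smul_apply, smul_eq_mul]
    linear_combination hab
  have h3 := (h1.pow (fun _ _ => norm_nonneg _) 2).add
    ((h2.pow (fun _ _ => le_max_right _ _) 2).smul hl)
  refine h3.congr fun x _ => ?_
  simp only [rimFunction, Pi.add_apply, Pi.pow_apply, smul_eq_mul, norm_sub_axis_sq]
  ring

lemma continuous_apply_zero (d : ℕ) : Continuous fun x : E (d + 2) => x 0 := by fun_prop

/-- The cylinder of radius `1` over `-1 ≤ x 0 ≤ 1`, extended up to the height `1 + δ` by part of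
an ellipsoid of revolution. -/
noncomputable def rimBody (d : ℕ) {l δ : ℝ} (hl : 0 ≤ l) (hδ : 0 ≤ δ) : ConvexBody (E (d + 2)) where
  carrier := {x | -1 ≤ x 0 ∧ x 0 ≤ 1 + δ ∧ rimFunction l x ≤ 1}
  convex' := by
    have h0 : IsLinearMap ℝ fun x : E (d + 2) => x 0 := ⟨fun _ _ => rfl, fun _ _ => rfl⟩
    refine (convex_halfSpace_ge h0 _).inter ((convex_halfSpace_le h0 _).inter ?_)
    have := (convexOn_rimFunction (d := d) hl).convex_le 1
    simp only [Set.mem_univ, true_and] at this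
    exact this
  isCompact' := by
    refine Metric.isCompact_of_isClosed_isBounded ?_ ?_
    · exact (isClosed_le continuous_const (continuous_apply_zero d)).inter
        ((isClosed_le (continuous_apply_zero d) continuous_const).inter
        (isClosed_le (continuous_rimFunction l) continuous_const))
    · refine (Metric.isBounded_closedBall (x := 0) (r := 2 + δ)).subset fun x hx => ?_
      obtain ⟨h1, h2, h3⟩ := hx
      rw [mem_closedBall_zero_iff]
      refine (abs_le_of_sq_le_sq' ?_ (by linarith)).2
      have : 0 ≤ l * max (x 0 - 1) 0 ^ 2 := by positivity
      rw [rimFunction] at h3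
      nlinarith
  nonempty' := ⟨0, by simp, by simp; linarith, by simp [rimFunction]⟩

lemma mem_rimBody {d : ℕ} {l δ : ℝ} {hl : 0 ≤ l} {hδ : 0 ≤ δ} {x : E (d + 2)} :
    x ∈ rimBody d hl hδ ↔ -1 ≤ x 0 ∧ x 0 ≤ 1 + δ ∧ rimFunction l x ≤ 1 := Iff.rfl

lemma rimFunction_of_le {d : ℕ} (l : ℝ) {x : E (d + 2)} (hx : x 0 ≤ 1) :
    rimFunction l x = ‖x‖ ^ 2 - x 0 ^ 2 := by
  rw [rimFunction, max_eq_right (by linarith)]; ring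

lemma rimFunction_of_ge {d : ℕ} (l : ℝ) {x : E (d + 2)} (hx : 1 ≤ x 0) :
    rimFunction l x = ‖x‖ ^ 2 - x 0 ^ 2 + l * (x 0 - 1) ^ 2 := by
  rw [rimFunction, max_eq_left (by linarith)]

lemma mem_interior_rimBody {d : ℕ} {l δ : ℝ} {hl : 0 ≤ l} {hδ : 0 ≤ δ} {x : E (d + 2)}
    (h1 : -1 < x 0) (h2 : x 0 < 1 + δ) (h3 : rimFunction l x < 1) :
    x ∈ interior (rimBody d hl hδ : Set (E (d + 2))) := by
  rw [mem_interior]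
  refine ⟨{x | -1 < x 0} ∩ ({x | x 0 < 1 + δ} ∩ {x | rimFunction l x < 1}), ?_, ?_, h1, h2, h3⟩
  · rintro y ⟨a, b, c⟩
    exact ⟨le_of_lt a, le_of_lt b, le_of_lt c⟩
  · exact (isOpen_lt continuous_const (continuous_apply_zero d)).inter
      ((isOpen_lt (continuous_apply_zero d) continuous_const).inter
      (isOpen_lt (continuous_rimFunction l) continuous_const))

lemma rimBody_mem_bodiesAroundOrigin {d : ℕ} {l δ : ℝ} (hl : 0 ≤ l) (hδ : 0 ≤ δ) :
    rimBody d hl hδ ∈ bodiesAroundOrigin (d + 2) :=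
  mem_interior_rimBody (by simp) (by simp; linarith) (by simp [rimFunction])

/-- The curved part of the boundary of `rimBody`. -/
def rim (d : ℕ) (l δ : ℝ) : Set (E (d + 2)) :=
  {x | 1 < x 0 ∧ x 0 < 1 + δ ∧ rimFunction l x = 1}

lemma measurableSet_rim (d : ℕ) (l δ : ℝ) : MeasurableSet (rim d l δ) := by
  exact (isOpen_lt continuous_const (continuous_apply_zero d)).measurableSet.inter
    ((isOpen_lt (continuous_apply_zero d) continuous_const).measurableSet.inter
    (isClosed_eq (continuous_rimFunction l) continuous_const).measurableSet)

/-- The edges of `rimBody`, where the boundary is not smooth. -/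
def rimEdges (d : ℕ) (l δ : ℝ) : Set (E (d + 2)) :=
  {x | x 0 = -1 ∧ ‖x‖ ^ 2 - x 0 ^ 2 = 1} ∪ ({x | x 0 = 1 ∧ ‖x‖ ^ 2 - x 0 ^ 2 = 1} ∪
    {x | x 0 = 1 + δ ∧ ‖x‖ ^ 2 - x 0 ^ 2 = 1 - l * δ ^ 2})

lemma surfaceMeasure_rimEdges {d : ℕ} (l δ : ℝ) (K : ConvexBody (E (d + 2))) :
    surfaceMeasure K (rimEdges d l δ) = 0 := by
  refine Measure.absolutelyContinuous_of_le Measure.restrict_le_self ?_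
  have h : ∀ c r : ℝ, Measure.euclideanHausdorffMeasure (d + 1)
      {x : E (d + 2) | x 0 = c ∧ ‖x‖ ^ 2 - x 0 ^ 2 = r} = 0 := fun c r =>
    measure_hyperplane_inter_sphere_eq_zero (by omega) 0 c r
  exact measure_union_null (h _ _) (measure_union_null (h _ _) (h _ _))

/-- What remains of the boundary is two flat discs, with segments orthogonal to the axis, and the
lateral cylinder, with segments parallel to it. -/
lemma exists_segment_rimBody {d : ℕ} {l δ : ℝ} {hl : 0 ≤ l} {hδ : 0 ≤ δ} {x : E (d + 2)}
    (hx : x ∈ frontier (rimBody d hl hδ : Set (E (d + 2)))) (hedge : x ∉ rimEdges d l δ)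
    (hrim : x ∉ rim d l δ) :
    ∃ e ≠ 0, x + e ∈ rimBody d hl hδ ∧ x - e ∈ rimBody d hl hδ := by
  have hxK : x ∈ rimBody d hl hδ := (rimBody d hl hδ).isClosed.frontier_subset hx
  obtain ⟨h1, h2, h3⟩ := hxK
  have hlat : rimFunction l x < 1 → ∃ e ≠ 0, x + e ∈ rimBody d hl hδ ∧ x - e ∈ rimBody d hl hδ := by
    intro hlt
    -- A move orthogonal to the axis preserves the height, and a small one keeps `rimFunction` below
    -- `1` by continuity.
    set b : E (d + 2) := EuclideanSpace.single 1 1 with hb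
    have hb0 : b 0 = 0 := by simp [hb]
    have hbne : b ≠ 0 := by simp [hb]
    have key : ∀ c : E (d + 2), c 0 = 0 → ∀ᶠ s in 𝓝[>] (0 : ℝ), x + s • c ∈ rimBody d hl hδ := by
      intro c hc
      have hc1 : Continuous fun s : ℝ => rimFunction l (x + s • c) :=
        (continuous_rimFunction l).comp (by fun_prop)
      have := (hc1.tendsto 0).eventually_lt_const (u := 1) (by simpa using hlt)
      filter_upwards [this.filter_mono nhdsWithin_le_nhds] with s hs
      have h0 : (x + s • c) 0 = x 0 := by simp [hc]
      exact ⟨by rw [h0]; exact h1, by rw [h0]; exact h2, hs.le⟩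
    obtain ⟨s, hs1, hs2, hs0⟩ := ((key b hb0).and ((key (-b) (by simp [hb0])).and
      self_mem_nhdsWithin)).exists
    refine ⟨s • b, smul_ne_zero (ne_of_gt hs0) hbne, hs1, ?_⟩
    rwa [smul_neg, ← sub_eq_add_neg] at hs2
  simp only [rimEdges, Set.mem_union, Set.mem_ofPred_eq, not_or, not_and] at hedge
  obtain ⟨e1, e2, e3⟩ := hedge
  rcases lt_or_eq_of_le h3 with hlt | heq
  · exact hlat hlt
  rcases eq_or_ne (x 0) (-1) with hm | hm
  · rw [rimFunction_of_le l (by linarith)] at heq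
    exact absurd heq (e1 hm)
  rcases eq_or_ne (x 0) (1 + δ) with ht | ht
  · rw [rimFunction_of_ge l (by linarith)] at heq
    have : x 0 - 1 = δ := by linarith
    rw [this] at heq
    exact absurd (by linarith) (e3 ht)
  have h1' : -1 < x 0 := lt_of_le_of_ne h1 (Ne.symm hm)
  have h2' : x 0 < 1 + δ := lt_of_le_of_ne h2 ht
  rcases lt_trichotomy (x 0) 1 with hlt | h | hgt
  · have hs : 0 < min (x 0 + 1) (1 - x 0) := lt_min (by linarith) (by linarith)
    set s := min (x 0 + 1) (1 - x 0)
    have hs1 : s ≤ x 0 + 1 := min_le_left _ _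
    have hs2 : s ≤ 1 - x 0 := min_le_right _ _
    rw [rimFunction_of_le l hlt.le] at heq
    have key : ∀ a : ℝ, |a| ≤ s → x - a • axis d ∈ rimBody d hl hδ := fun a ha => by
      have ha' := abs_le.1 ha
      have h0 : (x - a • axis d) 0 = x 0 - a := by simp [axis_zero]
      refine ⟨by rw [h0]; linarith, by rw [h0]; linarith, ?_⟩
      rw [rimFunction_of_le l (by rw [h0]; linarith), h0, norm_sub_axis_sq]
      nlinarith
    refine ⟨s • axis d, smul_ne_zero hs.ne' ?_, ?_, key s (abs_of_pos hs).le⟩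
    · rw [← norm_ne_zero_iff, norm_axis]; exact one_ne_zero
    · have := key (-s) (by rw [abs_neg, abs_of_pos hs])
      rwa [neg_smul, sub_neg_eq_add] at this
  · rw [rimFunction_of_le l h.le] at heq
    exact absurd heq (e2 h)
  · exact absurd ⟨hgt, h2', heq⟩ hrim

lemma curvatureH_rimBody_ae {d : ℕ} {l δ : ℝ} (hl : 0 ≤ l) (hδ : 0 ≤ δ) :
    ∀ᵐ x ∂(surfaceMeasure (rimBody d hl hδ)), x ∉ rim d l δ →
      curvatureH (rimBody d hl hδ) (d + 2 - 1) x = 0 := by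
  filter_upwards [compl_mem_ae_iff.2 (surfaceMeasure_rimEdges l δ (rimBody d hl hδ)),
    surfaceMeasure_ae_mem_frontier (rimBody d hl hδ)] with x hedge hx hrim
  obtain ⟨e, he, h₁, h₂⟩ := exists_segment_rimBody hx hedge hrim
  exact curvatureH_eq_zero_of_segment (by omega) (rimBody_mem_bodiesAroundOrigin hl hδ) hx he h₁ h₂

lemma rim_zero (d : ℕ) (l : ℝ) : rim d l 0 = ∅ := by
  ext x
  simp only [rim, Set.mem_ofPred_eq, Set.mem_empty_iff_false, iff_false]
  rintro ⟨h1, h2, -⟩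
  linarith

/-- For `δ = 0` the parameter `l` plays no role, so the reference body is the plain cylinder. Each
point is lowered by its excess over height `1`. -/
lemma dist_rimBody_le {d : ℕ} {l δ : ℝ} (hl : 0 ≤ l) (hδ : 0 ≤ δ) :
    dist (rimBody d hl hδ) (rimBody d zero_le_one le_rfl) ≤ δ := by
  rw [← ConvexBody.hausdorffDist_coe]
  refine Metric.hausdorffDist_le_of_mem_dist hδ (fun x hx => ?_) fun x hx => ⟨x, ?_, by simpa⟩
  · obtain ⟨h1, h2, h3⟩ := hx
    set a := max (x 0 - 1) 0 with ha
    have ha0 : 0 ≤ a := le_max_right _ _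
    have ha1 : x 0 - 1 ≤ a := le_max_left _ _
    have haδ : a ≤ δ := max_le (by linarith) hδ
    have h0 : (x - a • axis d) 0 = x 0 - a := by simp [axis_zero]
    refine ⟨x - a • axis d, ⟨?_, ?_, ?_⟩, ?_⟩
    · rw [h0]
      rcases max_choice (x 0 - 1) 0 with h | h <;> rw [← ha] at h <;> linarith
    · rw [h0]; linarith
    · rw [rimFunction_of_le _ (by rw [h0]; linarith), h0, norm_sub_axis_sq]
      have : 0 ≤ l * a ^ 2 := by positivity
      rw [rimFunction, ← ha] at h3
      nlinarith
    · rw [dist_eq_norm, sub_sub_cancel, norm_smul, norm_axis, mul_one, Real.norm_of_nonneg ha0]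
      exact haδ
  · obtain ⟨h1, h2, h3⟩ := hx
    rw [add_zero] at h2
    rw [rimFunction_of_le _ h2] at h3
    exact ⟨h1, by linarith, by rwa [rimFunction_of_le _ h2]⟩

/-! ### The curved rim -/

/-- The rim lies on the ellipsoid centred at `axis d` with quadratic form `stretch (axis d) l`. -/
lemma inner_stretch_sub_axis {d : ℕ} {l δ : ℝ} {x : E (d + 2)} (hx : x ∈ rim d l δ) :
    inner ℝ (stretch (axis d) l (x - axis d)) (x - axis d) = 1 := by
  obtain ⟨h1, -, h3⟩ := hx
  rw [rimFunction_of_ge l h1.le] at h3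
  have := norm_sub_axis_sq x 1
  rw [one_smul] at this
  rw [inner_stretch, real_inner_self_eq_norm_sq, this, inner_axis, PiLp.sub_apply, axis_zero]
  linarith

lemma isLocallyQuadric_rimBody {d : ℕ} {l δ : ℝ} {hl : 0 ≤ l} {hδ : 0 ≤ δ} {x : E (d + 2)}
    (hx : x ∈ rim d l δ) :
    IsLocallyQuadric (rimBody d hl hδ) x (stretch (axis d) l (x - axis d))
      (stretch (axis d) l) := by
  obtain ⟨h1, h2, h3⟩ := hx
  -- Within this radius the height stays between `1` and `1 + δ`, where only the ellipsoid equation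
  -- matters.
  refine ⟨min (x 0 - 1) (1 + δ - x 0), lt_min (by linarith) (by linarith), fun h hh => ?_⟩
  have hh0 : |h 0| ≤ ‖h‖ := by simpa using PiLp.norm_apply_le h 0
  have hh1 := (hh0.trans_lt hh).trans_le (min_le_left _ _)
  have hh2 := (hh0.trans_lt hh).trans_le (min_le_right _ _)
  rw [abs_lt] at hh1 hh2
  have h0 : (x + h) 0 = x 0 + h 0 := rfl
  rw [mem_rimBody, h0]
  have a : -1 ≤ x 0 + h 0 := by linarith
  have b : x 0 + h 0 ≤ 1 + δ := by linarith
  simp only [a, b, true_and]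
  rw [rimFunction_of_ge l (by rw [h0]; linarith), h0, inner_stretch, inner_stretch, inner_axis,
    inner_axis, PiLp.sub_apply, axis_zero, inner_sub_left, inner_axis, norm_add_sq_real,
    real_inner_self_eq_norm_sq]
  rw [rimFunction_of_ge l h1.le] at h3
  constructor <;> intro h <;> nlinarith

lemma rim_subset_frontier {d : ℕ} {l δ : ℝ} (hl : 0 ≤ l) (hδ : 0 ≤ δ) :
    rim d l δ ⊆ frontier (rimBody d hl hδ : Set (E (d + 2))) := by
  intro x hx
  refine ⟨subset_closure ⟨by linarith [hx.1], hx.2.1.le, hx.2.2.le⟩, fun hint => ?_⟩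
  obtain ⟨ρ, hρ, hloc⟩ := isLocallyQuadric_rimBody (hl := hl) (hδ := hδ) hx
  have hz := inner_stretch_sub_axis hx
  set z := x - axis d
  have h1 : ∀ᶠ s : ℝ in 𝓝[>] 0, x + s • z ∈ rimBody d hl hδ ∧ ‖s • z‖ < ρ := by
    have c1 : Continuous fun s : ℝ => x + s • z := by fun_prop
    have c2 : Continuous fun s : ℝ => ‖s • z‖ := by fun_prop
    refine Filter.Eventually.filter_mono nhdsWithin_le_nhds (Filter.Eventually.and ?_ ?_)
    · refine c1.continuousAt.eventually_mem ?_
      simpa using mem_interior_iff_mem_nhds.1 hint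
    · exact c2.continuousAt.eventually_lt_const (by simpa using hρ)
  obtain ⟨s, ⟨hs1, hs2⟩, hs0⟩ := (h1.and self_mem_nhdsWithin).exists
  have hs0 : 0 < s := hs0
  -- At `h = s • z`, pointing away from the centre, the local polynomial is `2s + s² > 0`.
  have := (hloc _ hs2).1 hs1
  simp only [map_smul, inner_smul_left, inner_smul_right, conj_trivial, hz] at this
  nlinarith

/-- The length of the gradient on the rim at height `t`. -/
noncomputable def rimWeight (l t : ℝ) : ℝ := √(1 + (l ^ 2 - l) * (t - 1) ^ 2)

lemma rimWeight_sq {l : ℝ} (hl : 1 ≤ l) (t : ℝ) :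
    rimWeight l t ^ 2 = 1 + (l ^ 2 - l) * (t - 1) ^ 2 :=
  Real.sq_sqrt (by nlinarith [mul_nonneg (by nlinarith : 0 ≤ l ^ 2 - l) (sq_nonneg (t - 1))])

lemma one_le_rimWeight {l : ℝ} (hl : 1 ≤ l) (t : ℝ) : 1 ≤ rimWeight l t :=
  Real.one_le_sqrt.2 (by nlinarith [mul_nonneg (by nlinarith : 0 ≤ l ^ 2 - l) (sq_nonneg (t - 1))])

lemma norm_stretch_sub_axis {d : ℕ} {l δ : ℝ} {x : E (d + 2)}
    (hx : x ∈ rim d l δ) : ‖stretch (axis d) l (x - axis d)‖ = rimWeight l (x 0) := by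
  have h := inner_stretch_sub_axis hx
  rw [rimWeight, ← Real.sqrt_sq (norm_nonneg _)]
  congr 1
  rw [inner_stretch, inner_axis, PiLp.sub_apply, axis_zero] at h
  rw [← real_inner_self_eq_norm_sq, inner_stretch, stretch_apply, inner_add_right,
    inner_add_right, inner_smul_right, inner_smul_right, inner_axis, inner_axis,
    inner_axis_right, axis_zero, PiLp.sub_apply, axis_zero]
  linear_combination h

lemma outerNormal_rimBody {d : ℕ} {l δ : ℝ} (hl : 0 ≤ l) (hδ : 0 ≤ δ) {x : E (d + 2)}
    (hx : x ∈ rim d l δ) : outerNormal (rimBody d hl hδ) x =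
      (rimWeight l (x 0))⁻¹ • stretch (axis d) l (x - axis d) := by
  rw [← norm_stretch_sub_axis hx]
  refine (isLocallyQuadric_rimBody hx).eq_of_isOuterUnitNormal ?_
    (isOuterUnitNormal_outerNormal (rimBody_mem_bodiesAroundOrigin hl hδ)
      (rim_subset_frontier hl hδ hx))
  intro h0
  have := inner_stretch_sub_axis hx
  rw [h0, inner_zero_left] at this
  exact zero_ne_one this

/-- On the rim the `max` is just `x 0 - 1`. It is kept so that the base of the power in
`rimIntegrand` is positive and continuous at every height. -/
lemma inner_outerNormal_rimBody {d : ℕ} {l δ : ℝ} (hl : 0 ≤ l) (hδ : 0 ≤ δ) {x : E (d + 2)}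
    (hx : x ∈ rim d l δ) : inner ℝ x (outerNormal (rimBody d hl hδ) x) =
      (1 + l * max (x 0 - 1) 0) / rimWeight l (x 0) := by
  rw [outerNormal_rimBody hl hδ hx, inner_smul_right, real_inner_comm, div_eq_inv_mul,
    max_eq_left (by linarith [hx.1])]
  congr 1
  have h := inner_stretch_sub_axis hx
  rw [inner_sub_right] at h
  have h2 : inner ℝ (stretch (axis d) l (x - axis d)) (axis d) = l * (x 0 - 1) := by
    rw [inner_stretch, real_inner_comm, inner_axis, inner_axis, axis_zero, PiLp.sub_apply,
      axis_zero]
    ring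
  linarith

/-- The entry `l / w ^ 3` belongs to the meridian direction, the only one in which the curvature
grows with `l`. -/
lemma principalCurvatures_rimBody {d : ℕ} {l δ : ℝ} (hl : 1 ≤ l) (hδ : 0 ≤ δ) {x : E (d + 2)}
    (hx : x ∈ rim d l δ) : principalCurvatures (rimBody d (zero_le_one.trans hl) hδ) x =
      (l / rimWeight l (x 0) ^ 3) ::ₘ Multiset.replicate d (rimWeight l (x 0))⁻¹ := by
  have hl0 := zero_le_one.trans hl
  have hw := one_le_rimWeight hl (x 0)
  have hw2 := rimWeight_sq hl (x 0)
  have hnorm := norm_stretch_sub_axis hx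
  have hN := isOuterUnitNormal_outerNormal (rimBody_mem_bodiesAroundOrigin (d := d) hl0 hδ)
      (rim_subset_frontier hl0 hδ hx)
  rw [(isLocallyQuadric_rimBody hx).principalCurvatures_eq (by omega) (norm_axis d) hl
    (by rw [← norm_ne_zero_iff, hnorm]; positivity) hN, hnorm, outerNormal_rimBody hl0 hδ hx,
    inner_smul_right, inner_axis]
  have h2 : (stretch (axis d) l (x - axis d)) 0 = l * (x 0 - 1) := by
    rw [← inner_axis, real_inner_comm, inner_stretch, real_inner_comm, inner_axis, inner_axis,
      axis_zero, PiLp.sub_apply, axis_zero]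
    ring
  rw [h2, Nat.add_sub_cancel]
  congr 1
  set w := rimWeight l (x 0)
  have hw0 : w ≠ 0 := by positivity
  field_simp
  linear_combination l * hw2

/-- The elementary symmetric functions of the principal curvatures on the rim at height `t`. -/
noncomputable def rimEsymm (d : ℕ) (l t : ℝ) (j : ℕ) : ℝ :=
  d.choose (j + 1) * (rimWeight l t)⁻¹ ^ (j + 1) +
    l / rimWeight l t ^ 3 * (d.choose j * (rimWeight l t)⁻¹ ^ j)

/-- The Steiner integrand on the rim, as a function of the height `t`. -/
noncomputable def rimIntegrand (d : ℕ) (l : ℝ) (m k : ℕ) (t : ℝ) : ℝ :=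
  ((1 + l * max (t - 1) 0) / rimWeight l t) ^ ((m : ℝ) - k) *
    rimEsymm d l t d ^ ((1 : ℝ) / ((d + 2 : ℕ) + 1)) *
    steinerPolynomial (d + 2) m fun j => rimEsymm d l t j

lemma steinerIntegrand_rimBody {d : ℕ} {l δ : ℝ} (hl : 1 ≤ l) (hδ : 0 ≤ δ) {x : E (d + 2)}
    (hx : x ∈ rim d l δ) (m k : ℕ) :
    steinerIntegrand 1 m k (rimBody d (zero_le_one.trans hl) hδ) x =
      rimIntegrand d l m k (x 0) := by
  have h : ∀ j : ℕ, (principalCurvatures (rimBody d (zero_le_one.trans hl) hδ) x).esymm (j + 1) =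
      rimEsymm d l (x 0) j := fun j => by
    rw [principalCurvatures_rimBody hl hδ hx, esymm_cons_replicate, rimEsymm]
  -- `rimEsymm` at index `j` has degree `j + 1`, so index `d` is the Gauss curvature in dimension `d
  -- + 2`.
  have hH : curvatureH (rimBody d (zero_le_one.trans hl) hδ) (d + 2 - 1) x =
      rimEsymm d l (x 0) d := by
    rw [curvatureH, Nat.choose_self, Nat.cast_one, div_one, ← h]
    rfl
  rw [steinerIntegrand_one_eq, inner_outerNormal_rimBody _ hδ hx, hH, rimIntegrand]
  simp only [h]

lemma continuous_rimWeight (l : ℝ) : Continuous (rimWeight l) := by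
  unfold rimWeight
  fun_prop

lemma rimWeight_pos {l : ℝ} (hl : 1 ≤ l) (t : ℝ) : 0 < rimWeight l t :=
  zero_lt_one.trans_le (one_le_rimWeight hl t)

lemma continuous_rimEsymm (d : ℕ) {l : ℝ} (hl : 1 ≤ l) (j : ℕ) :
    Continuous fun t => rimEsymm d l t j := by
  have h1 := (continuous_rimWeight l).inv₀ fun t => (rimWeight_pos hl t).ne'
  simp only [rimEsymm, div_eq_mul_inv, ← inv_pow]
  exact (continuous_const.mul (h1.pow _)).add
    ((continuous_const.mul (h1.pow _)).mul (continuous_const.mul (h1.pow _)))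

lemma continuous_rimIntegrand (d : ℕ) {l : ℝ} (hl : 1 ≤ l) (m k : ℕ) :
    Continuous (rimIntegrand d l m k) := by
  have hbase : Continuous fun t => (1 + l * max (t - 1) 0) / rimWeight l t :=
    Continuous.div (by fun_prop) (continuous_rimWeight l) fun t => (rimWeight_pos hl t).ne'
  refine ((hbase.rpow_const fun t => Or.inl ?_).mul
    ((continuous_rimEsymm d hl d).rpow_const fun t => Or.inr (by positivity))).mul ?_
  · have := rimWeight_pos hl t
    have : 0 ≤ l * max (t - 1) 0 := mul_nonneg (by linarith) (le_max_right _ _)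
    positivity
  · unfold steinerPolynomial
    refine continuous_finsetSum _ fun i _ => continuous_const.mul ?_
    exact continuous_finsetProd _ fun j _ => (continuous_rimEsymm d hl j).pow _

lemma steinerIntegrand_rimBody_ae {d : ℕ} {l δ : ℝ} (hl : 1 ≤ l) (hδ : 0 ≤ δ) (m k : ℕ) :
    steinerIntegrand 1 m k (rimBody d (zero_le_one.trans hl) hδ) =ᵐ[surfaceMeasure
      (rimBody d (zero_le_one.trans hl) hδ)]
      (rim d l δ).indicator fun x => rimIntegrand d l m k (x 0) := by
  filter_upwards [curvatureH_rimBody_ae (d := d) (zero_le_one.trans hl) hδ] with x hx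
  by_cases h : x ∈ rim d l δ
  · rw [Set.indicator_of_mem h, steinerIntegrand_rimBody hl hδ h]
  · rw [Set.indicator_of_notMem h, steinerIntegrand_eq_zero (hx h)]

lemma integrable_rimIntegrand {d : ℕ} {l : ℝ} (hl : 1 ≤ l) (m k : ℕ) {K : ConvexBody (E (d + 2))}
    (hK : K ∈ bodiesAroundOrigin (d + 2)) :
    Integrable (fun x => rimIntegrand d l m k (x 0)) (surfaceMeasure K) := by
  have := isFiniteMeasure_surfaceMeasure hK
  have hcont : Continuous fun x : E (d + 2) => rimIntegrand d l m k (x 0) :=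
    (continuous_rimIntegrand d hl m k).comp (continuous_apply_zero d)
  obtain ⟨C, hC⟩ := K.isCompact.exists_bound_of_continuousOn hcont.continuousOn
  refine Integrable.of_bound hcont.aestronglyMeasurable C ?_
  filter_upwards [surfaceMeasure_ae_mem_frontier K] with x hx
  exact hC x (K.isClosed.frontier_subset hx)

lemma rimBody_mem_steinerDomain {d : ℕ} {l δ : ℝ} (hl : 1 ≤ l) (hδ : 0 ≤ δ) :
    rimBody d (zero_le_one.trans hl) hδ ∈ steinerDomain (d + 2) 1 := by
  have hK := rimBody_mem_bodiesAroundOrigin (d := d) (zero_le_one.trans hl) hδ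
  exact ⟨hK, fun m k => ((integrable_rimIntegrand hl m k hK).indicator
    (measurableSet_rim d l δ)).congr (steinerIntegrand_rimBody_ae hl hδ m k).symm⟩

lemma steinerW_rimBody {d : ℕ} {l δ : ℝ} (hl : 1 ≤ l) (hδ : 0 ≤ δ) (m k : ℕ) :
    steinerW 1 m k (rimBody d (zero_le_one.trans hl) hδ) =
      ∫ x in rim d l δ, rimIntegrand d l m k (x 0)
        ∂(surfaceMeasure (rimBody d (zero_le_one.trans hl) hδ)) := by
  rw [steinerW, integral_congr_ae (steinerIntegrand_rimBody_ae hl hδ m k),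
    integral_indicator (measurableSet_rim d l δ)]

/-! ### Estimates on a thin rim -/

/-- The rim height `1 / l` is chosen so that `l (t - 1) ≤ 1`, which bounds the weight independently
of `l`. -/
lemma rimWeight_sq_le_two {l t : ℝ} (hl : 1 ≤ l) (h1 : 1 < t) (h2 : t < 1 + l⁻¹) :
    rimWeight l t ^ 2 ≤ 2 := by
  have hl0 : 0 < l := by linarith
  rw [rimWeight_sq hl]
  have h3 : l * (t - 1) ≤ 1 := by
    have := mul_le_mul_of_nonneg_left (by linarith : t - 1 ≤ l⁻¹) hl0.le
    rwa [mul_inv_cancel₀ hl0.ne'] at this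
  have h4 : 0 ≤ l * (t - 1) := mul_nonneg hl0.le (by linarith)
  nlinarith [mul_nonneg hl0.le (sq_nonneg (t - 1))]

lemma rimCurvature_bounds {l t : ℝ} (hl : 1 ≤ l) (h1 : 1 < t) (h2 : t < 1 + l⁻¹) :
    l / 4 ≤ l / rimWeight l t ^ 3 ∧ l / rimWeight l t ^ 3 ≤ l := by
  have hw := one_le_rimWeight hl t
  have hw2 := rimWeight_sq_le_two hl h1 h2
  set w := rimWeight l t
  have hw3 : w ^ 3 ≤ 4 := by nlinarith
  refine ⟨by gcongr, div_le_self (by linarith) (one_le_pow₀ hw)⟩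

lemma rimEsymm_bounds (d : ℕ) {l t : ℝ} (hl : 1 ≤ l) (h1 : 1 < t) (h2 : t < 1 + l⁻¹) (j : ℕ) :
    0 ≤ rimEsymm d l t j ∧ rimEsymm d l t j ≤ 2 ^ (d + 2) * l := by
  have hw := one_le_rimWeight hl t
  obtain ⟨-, hκ⟩ := rimCurvature_bounds hl h1 h2
  have hl0 : 0 < l := by linarith
  have hch : ∀ j : ℕ, (d.choose j : ℝ) ≤ 2 ^ d := fun j => by
    exact_mod_cast Nat.choose_le_two_pow d j
  have hpow : ∀ j : ℕ, (rimWeight l t)⁻¹ ^ j ≤ 1 := fun j =>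
    pow_le_one₀ (by positivity) (inv_le_one_of_one_le₀ hw)
  have hterm : ∀ j : ℕ, (d.choose j : ℝ) * (rimWeight l t)⁻¹ ^ j ≤ 2 ^ d := fun j =>
    (mul_le_mul (hch j) (hpow j) (by positivity) (by positivity)).trans (mul_one _).le
  rw [rimEsymm]
  refine ⟨by positivity, ?_⟩
  calc _ ≤ (2 : ℝ) ^ d + l * 2 ^ d := add_le_add (hterm _)
        (mul_le_mul hκ (hterm _) (by positivity) hl0.le)
    _ ≤ 2 ^ (d + 2) * l := by
        rw [pow_add]; nlinarith [show (0 : ℝ) < 2 ^ d by positivity]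

lemma le_rimEsymm_zero (d : ℕ) {l t : ℝ} (hl : 1 ≤ l) (h1 : 1 < t) (h2 : t < 1 + l⁻¹) :
    l / 2 ^ (d + 2) ≤ rimEsymm d l t 0 := by
  have hw := one_le_rimWeight hl t
  obtain ⟨hκ, -⟩ := rimCurvature_bounds hl h1 h2
  have h4 : (4 : ℝ) ≤ 2 ^ (d + 2) := by
    rw [pow_add]; nlinarith [one_le_pow₀ (n := d) (one_le_two (α := ℝ))]
  have : l / 2 ^ (d + 2) ≤ l / 4 := by gcongr
  have : 0 ≤ (d.choose (0 + 1) : ℝ) * (rimWeight l t)⁻¹ ^ (0 + 1) := by positivity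
  rw [rimEsymm, Nat.choose_zero_right, pow_zero, Nat.cast_one, mul_one, mul_one]
  linarith

/-- A bound free of `l` suffices for the Gauss curvature; the growth is supplied by the first
symmetric function. -/
lemma le_rimEsymm_self (d : ℕ) {l t : ℝ} (hl : 1 ≤ l) (h1 : 1 < t) (h2 : t < 1 + l⁻¹) :
    1 / 4 * (1 / 2) ^ d ≤ rimEsymm d l t d := by
  have hw := one_le_rimWeight hl t
  have hw2 := rimWeight_sq_le_two hl h1 h2
  obtain ⟨hκ, -⟩ := rimCurvature_bounds hl h1 h2
  have hinv : 1 / 2 ≤ (rimWeight l t)⁻¹ := by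
    rw [one_div]
    exact inv_anti₀ (by linarith) (by nlinarith)
  rw [rimEsymm, Nat.choose_succ_self, Nat.choose_self, Nat.cast_zero, zero_mul, zero_add,
    Nat.cast_one, one_mul]
  exact mul_le_mul (by linarith) (pow_le_pow_left₀ (by norm_num) hinv d) (by positivity)
    (by positivity)

lemma exists_le_sign_mul_rimIntegrand (d : ℕ) {k : ℕ} (hk : 1 ≤ k) :
    ∃ σ c l₀ : ℝ, (σ = 1 ∨ σ = -1) ∧ 0 < c ∧ ∀ l, 1 ≤ l → l₀ ≤ l → ∀ t, 1 < t → t < 1 + l⁻¹ →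
      c * l ≤ σ * rimIntegrand d l k k t := by
  have hB : (1 : ℝ) ≤ 2 ^ (d + 2) := one_le_pow₀ one_le_two
  obtain ⟨σ, c, l₀, hσ, hc, h⟩ := exists_le_sign_mul_steinerPolynomial (n := d + 2) (by omega) hk
    ⟨0, by omega⟩ rfl hB
  set p : ℝ := (1 : ℝ) / ((d + 2 : ℕ) + 1)
  have hp : 0 ≤ p := by positivity
  set a : ℝ := (1 / 4 * (1 / 2) ^ d) ^ p
  have ha : 0 < a := by positivity
  refine ⟨σ, a * c, l₀, hσ, by positivity, fun l hl hl₀ t h1 h2 => ?_⟩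
  have hS := h l hl hl₀ (fun j => rimEsymm d l t j) (fun j => by
    obtain ⟨b1, b2⟩ := rimEsymm_bounds d hl h1 h2 j
    rwa [abs_of_nonneg b1]) (le_rimEsymm_zero d hl h1 h2)
  have hH : a ≤ rimEsymm d l t d ^ p :=
    Real.rpow_le_rpow (by positivity) (le_rimEsymm_self d hl h1 h2) hp
  -- Here `k ≥ 1` enters: growth at least linear in `l` compensates the rim area of order `1 / l`.
  have hlk : l ≤ l ^ k := le_self_pow₀ hl (by omega)
  rw [rimIntegrand, sub_self, Real.rpow_zero, one_mul, mul_left_comm, mul_assoc]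
  refine mul_le_mul hH (le_trans ?_ hS) (by positivity) (ha.le.trans hH)
  gcongr

/-- Forgetting the last coordinate is 1-Lipschitz, so it suffices that the image of the rim contains
a box of height `1 / l` and side `2 / (d + 1)`. On this box, `l ≥ 4` and `d / (d + 1)² ≤ 1 / 4` make
both subtracted terms at most `1 / 4`, so the forgotten coordinate `y` can be recovered as a square
root. -/
lemma rimMeasure_ge (d : ℕ) {l : ℝ} (hl : 4 ≤ l) :
    ENNReal.ofReal (l⁻¹ * (2 / (d + 1)) ^ d) ≤
      Measure.euclideanHausdorffMeasure (d + 1) (rim d l l⁻¹) := by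
  have hl0 : 0 < l := by linarith
  have hd : (0 : ℝ) < d + 1 := by positivity
  have hvol := volume_slab_box (d := d) 1 (1 + l⁻¹) (1 / (d + 1)) (by positivity)
  have e : (1 + l⁻¹ - 1) * (2 * (1 / (d + 1))) ^ d = l⁻¹ * (2 / ((d : ℝ) + 1)) ^ d := by
    rw [add_sub_cancel_left, mul_one_div]
  rw [e] at hvol
  rw [← hvol, ← EuclideanSpace.euclideanHausdorffMeasure_eq_volume]
  refine (measure_mono ?_).trans
    (euclideanHausdorffMeasure_image_le (lipschitzWith_forgetLast (d := d + 1)) (d + 1) _)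
  rintro w ⟨⟨hw1, hw2⟩, hw⟩
  set S := ∑ j : Fin d, w j.succ ^ 2 with hS
  have hS4 : S ≤ 1 / 4 := by
    have : S ≤ ∑ _j : Fin d, (1 / ((d : ℝ) + 1)) ^ 2 := Finset.sum_le_sum fun j _ => by
      rw [← sq_abs (w j.succ)]
      exact pow_le_pow_left₀ (abs_nonneg _) (abs_le.2 (hw j)) 2
    refine this.trans ?_
    rw [Finset.sum_const, Finset.card_univ, Fintype.card_fin, nsmul_eq_mul, div_pow, one_pow,
      mul_one_div, div_le_div_iff₀ (by positivity) (by norm_num)]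
    nlinarith [sq_nonneg ((d : ℝ) - 1)]
  have ht : l * (w 0 - 1) ^ 2 ≤ 1 / 4 := by
    have h1 : l * (w 0 - 1) ≤ 1 := by
      have := mul_le_mul_of_nonneg_left (by linarith : w 0 - 1 ≤ l⁻¹) hl0.le
      rwa [mul_inv_cancel₀ hl0.ne'] at this
    have h2 : l⁻¹ ≤ 1 / 4 := by
      rw [one_div]; exact inv_anti₀ (by norm_num) hl
    nlinarith
  set y := √(1 - l * (w 0 - 1) ^ 2 - S) with hy
  have hy2 : y ^ 2 = 1 - l * (w 0 - 1) ^ 2 - S := Real.sq_sqrt (by linarith)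
  set x : E (d + 2) := WithLp.toLp 2 (Fin.snoc (α := fun _ => ℝ) (WithLp.ofLp w) y) with hx
  have hxc : ∀ j : Fin (d + 1), x j.castSucc = w j := fun j => by simp [hx]
  have hxl : x (Fin.last (d + 1)) = y := by simp [hx]
  have hx0 : x 0 = w 0 := hxc 0
  have hnorm : ‖x‖ ^ 2 = w 0 ^ 2 + S + y ^ 2 := by
    rw [EuclideanSpace.real_norm_sq_eq, Fin.sum_univ_castSucc, hxl]
    simp only [hxc]
    rw [Fin.sum_univ_succ]
  refine ⟨x, ⟨by rw [hx0]; exact hw1, by rw [hx0]; exact hw2, ?_⟩, ?_⟩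
  · rw [rimFunction_of_ge l (by rw [hx0]; exact hw1.le), hx0, hnorm, hy2]
    ring
  · ext j
    exact hxc j

/-- On bodies with a thin rim, `𝒲_{k,k}` has a fixed sign and stays away from zero. -/
lemma exists_le_sign_mul_steinerW (d : ℕ) {k : ℕ} (hk : 1 ≤ k) :
    ∃ σ c l₀ : ℝ, (σ = 1 ∨ σ = -1) ∧ 0 < c ∧ ∀ l (hl : 1 ≤ l), l₀ ≤ l →
      c ≤ σ * steinerW 1 k k (rimBody d (zero_le_one.trans hl)
        (inv_nonneg.2 (zero_le_one.trans hl))) := by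
  obtain ⟨σ, c, l₀, hσ, hc, h⟩ := exists_le_sign_mul_rimIntegrand d hk
  refine ⟨σ, c * (2 / (d + 1)) ^ d, max l₀ 4, hσ, by positivity, fun l hl hl₀ => ?_⟩
  have hl0 : 0 < l := by linarith
  have hδ : 0 ≤ l⁻¹ := inv_nonneg.2 hl0.le
  set K := rimBody d (zero_le_one.trans hl) hδ with hK
  have hKo : K ∈ bodiesAroundOrigin (d + 2) := rimBody_mem_bodiesAroundOrigin _ _
  have := isFiniteMeasure_surfaceMeasure hKo
  have hμ : l⁻¹ * (2 / (d + 1)) ^ d ≤ (surfaceMeasure K).real (rim d l l⁻¹) := by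
    rw [Measure.real, ← ENNReal.ofReal_le_iff_le_toReal (measure_ne_top _ _), surfaceMeasure,
      Measure.restrict_apply (measurableSet_rim d l l⁻¹),
      Set.inter_eq_left.2 (rim_subset_frontier _ hδ)]
    exact rimMeasure_ge d ((le_max_right _ _).trans hl₀)
  have hint := integrable_rimIntegrand hl k k hKo
  rw [steinerW_rimBody hl hδ, ← integral_const_mul]
  calc c * (2 / (d + 1)) ^ d = c * l * (l⁻¹ * (2 / (d + 1)) ^ d) := by field_simp
    _ ≤ c * l * (surfaceMeasure K).real (rim d l l⁻¹) := by gcongr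
    _ = ∫ _x in rim d l l⁻¹, c * l ∂(surfaceMeasure K) := by
        rw [setIntegral_const, smul_eq_mul, mul_comm]
    _ ≤ _ := setIntegral_mono_on (integrable_const _).integrableOn (hint.const_mul σ).integrableOn
        (measurableSet_rim d l l⁻¹)
        fun x hx => h l hl ((le_max_left _ _).trans hl₀) _ hx.1 hx.2.1

/-! ### Semicontinuity -/

lemma not_lowerSemicontinuousOn_of_forall_exists {X : Type*} [PseudoMetricSpace X] {f : X → ℝ}
    {s : Set X} {x : X} (hx : x ∈ s) {y : ℝ} (hy : y < f x)
    (h : ∀ ε > 0, ∃ z ∈ s, dist z x ≤ ε ∧ f z ≤ y) : ¬ LowerSemicontinuousOn f s := by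
  intro hf
  obtain ⟨ε, hε, hball⟩ := Metric.mem_nhdsWithin_iff.1 (hf x hx y hy)
  obtain ⟨z, hz, hzx, hfz⟩ := h (ε / 2) (by positivity)
  exact absurd (hball ⟨Metric.mem_ball.2 (by linarith), hz⟩ : y < f z) hfz.not_gt

lemma not_upperSemicontinuousOn_of_forall_exists {X : Type*} [PseudoMetricSpace X] {f : X → ℝ}
    {s : Set X} {x : X} (hx : x ∈ s) {y : ℝ} (hy : f x < y)
    (h : ∀ ε > 0, ∃ z ∈ s, dist z x ≤ ε ∧ y ≤ f z) : ¬ UpperSemicontinuousOn f s := by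
  intro hf
  obtain ⟨ε, hε, hball⟩ := Metric.mem_nhdsWithin_iff.1 (hf x hx y hy)
  obtain ⟨z, hz, hzx, hfz⟩ := h (ε / 2) (by positivity)
  exact absurd (hball ⟨Metric.mem_ball.2 (by linarith), hz⟩ : f z < y) hfz.not_gt

end LpSteiner

open LpSteiner in
/-- For all `n ≥ 2` and `k ≥ 1`, `𝒱^1_k = 𝒲^1_{k,k}` is neither lower nor upper semicontinuous
with respect to the Hausdorff metric. -/
theorem mainTheorem9 (n : ℕ) (hn : 2 ≤ n) (k : ℕ) (hk : 1 ≤ k) :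
    (∀ K ∈ bodiesAroundOrigin n, steinerV 1 k K = steinerW 1 k k K) ∧
      ¬ LowerSemicontinuousOn (steinerW (n := n) 1 k k) (steinerDomain n 1) ∧
      ¬ UpperSemicontinuousOn (steinerW (n := n) 1 k k) (steinerDomain n 1) := by
  refine ⟨fun K _ => steinerV_one_eq k K, ?_⟩
  obtain ⟨d, rfl⟩ : ∃ d, n = d + 2 := ⟨n - 2, by omega⟩
  obtain ⟨σ, c, l₀, hσ, hc, hW⟩ := exists_le_sign_mul_steinerW d hk
  have hl₁ : 1 ≤ max 1 l₀ := le_max_left _ _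
  set L := rimBody d (zero_le_one.trans hl₁) (inv_nonneg.2 (zero_le_one.trans hl₁)) with hL
  have hLD : L ∈ steinerDomain (d + 2) 1 := rimBody_mem_steinerDomain hl₁ _
  have hLW : c ≤ σ * steinerW 1 k k L := hW _ hl₁ (le_max_right _ _)
  have hpoly : ∀ ε > 0, ∃ P ∈ steinerDomain (d + 2) 1, dist P L ≤ ε ∧ steinerW 1 k k P = 0 := by
    intro ε hε
    obtain ⟨P, hP, hdist, hcurv⟩ := exists_dist_le_curvatureH_eq_zero hn hLD.1 hε
    exact ⟨P, mem_steinerDomain_of_curvatureH_eq_zero hP hcurv, hdist,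
      steinerW_eq_zero_of_curvatureH_eq_zero hcurv k k⟩
  set Z := rimBody d zero_le_one le_rfl with hZ
  have hZcurv : ∀ᵐ x ∂(surfaceMeasure Z), curvatureH Z (d + 2 - 1) x = 0 := by
    filter_upwards [curvatureH_rimBody_ae (d := d) zero_le_one le_rfl] with x hx
    exact hx (by rw [rim_zero]; exact Set.notMem_empty x)
  have hZD : Z ∈ steinerDomain (d + 2) 1 := mem_steinerDomain_of_curvatureH_eq_zero
    (rimBody_mem_bodiesAroundOrigin _ _) hZcurv
  have hZW : steinerW 1 k k Z = 0 := steinerW_eq_zero_of_curvatureH_eq_zero hZcurv k k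
  have hrim : ∀ ε > 0, ∃ K ∈ steinerDomain (d + 2) 1, dist K Z ≤ ε ∧ c ≤ σ * steinerW 1 k k K := by
    intro ε hε
    -- Taking `l ≥ ε⁻¹` makes the rim height `l⁻¹` at most `ε`.
    have hl : 1 ≤ max (max 1 l₀) ε⁻¹ := hl₁.trans (le_max_left _ _)
    refine ⟨rimBody d (zero_le_one.trans hl) (inv_nonneg.2 (zero_le_one.trans hl)),
      rimBody_mem_steinerDomain hl _, (dist_rimBody_le _ _).trans ?_,
      hW _ hl ((le_max_right _ _).trans (le_max_left _ _))⟩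
    exact inv_le_of_inv_le₀ hε (le_max_right _ _)
  -- For `σ = 1` the value drops to `0` along polytopes near `L` and jumps up near `Z`; for `σ = -1`
  -- the two roles are exchanged.
  rcases hσ with rfl | rfl
  · refine ⟨not_lowerSemicontinuousOn_of_forall_exists hLD (y := 0) (by linarith) fun ε hε => ?_,
      not_upperSemicontinuousOn_of_forall_exists hZD (y := c) (by linarith) fun ε hε => ?_⟩
    · obtain ⟨P, hP, hdist, h0⟩ := hpoly ε hε
      exact ⟨P, hP, hdist, h0.le⟩
    · obtain ⟨K, hK, hdist, hKc⟩ := hrim ε hε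
      exact ⟨K, hK, hdist, by linarith⟩
  · refine ⟨not_lowerSemicontinuousOn_of_forall_exists hZD (y := -c) (by linarith) fun ε hε => ?_,
      not_upperSemicontinuousOn_of_forall_exists hLD (y := 0) (by linarith) fun ε hε => ?_⟩
    · obtain ⟨K, hK, hdist, hKc⟩ := hrim ε hε
      exact ⟨K, hK, hdist, by linarith⟩
    · obtain ⟨P, hP, hdist, h0⟩ := hpoly ε hε
      exact ⟨P, hP, hdist, h0.ge⟩
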